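/- **Theorem (Joint Moment Generating Function of a bivariate common-shock phase-type distribution).** Let $\mathcal E,\mathcal S$ be finite sets, $\alpha$ a probability vector on $\mathcal E$, and $T$ on $\mathcal E$ and $Q_1,Q_2$ on $\mathcal S$ subintensity matrices (nonnegative off-diagonal entries, nonpositive row sums) all of whose states are transient, i.e. $e^{tT}\to0$ and $e^{tQ_i}\to 0$ as $t\to\infty$. Let $U\ge 0$ be an $\mathcal E\times\mathcal S$ matrix with $T\mathbf 1+U\mathbf 1=0$, and let $a_1,a_2>0$. Let $J_{1,2}$ be a Markov jump process on $\mathcal E\cup\mathcal S$ with initial distribution $(\alpha,0)$ and intensity matrix $\begin{pmatrix}T&U\\0&0\end{pmatrix}$, and put $\tau_{1,2}=\inf\{t\ge0: J_{1,2}(t)\notin\mathcal E\}$ and $K=J_{1,2}(\tau_{1,2})\in\mathcal S$. Let $J_1,J_2$ be jump processes on $\mathcal E\cup\mathcal S\cup\{\partial\}$ that coincide with $J_{1,2}$ up to and including time $\tau_{1,2}$ and such that, given $J_{1,2}$, the processes $(J_i(\tau_{1,2}+t))_{t\ge0}$, $i=1,2$, are independent Markov jump processes started from $K$ and governed on $\mathcal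 S$ by $Q_i$ until absorption in $\partial$, which is entered from $\mathcal S$ at the rates $q_i=-Q_i\mathbf 1$. Let $\tilde\tau_i$ be the time from $\tau_{1,2}$ until $J_i$ is absorbed. A random vector $(X_1,X_2)$ has the CSPH distribution with parameters $(\alpha,T,U,Q_1,Q_2,a_1,a_2)$ if it has the law of $(a_1\tau_{1,2}+\tilde\tau_1,\;a_2\tau_{1,2}+\tilde\tau_2)$. Then there is $\delta>0$, depending only on the parameters, such that for every such $(X_1,X_2)$ and all real $s_1,s_2$ with $|s_1|,|s_2|<\delta$ the matrix inverses below exist, all the expectations below are finite, and $$M_{X_1,X_2}(s_1,s_2)=\mathbb E\big[e^{s_1X_1+s_2X_2}\big]=\sum_{k\in\mathcal S}M^{(k)}_{\tau_{1,2}}(a_1s_1+a_2s_2)\,M_{\tilde\tau_1\mid K=k}(s_1)\,M_{\tilde\tau_2\mid K=k}(s_2).$$ Here, with $u^{(k)}$ the $k$-th column of $U$ and $e_k$ the $k$-th unit vector, $$M^{(k)}_{\tau_{1,2}}(s)=\alpha(-T-sI)^{-1}u^{(k)},\qquad M_{\tilde\tau_i\mid K=k}(s)=e_k^\top(-Q_i-sI)^{-1}q_i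 .$$ Moreover, for every $k\in\mathcal S$ and the same $s_1,s_2$, these functions are the corresponding transforms: $$M^{(k)}_{\tau_{1,2}}(s)=\mathbb E\big[e^{s\tau_{1,2}}\mathbf 1_{\{K=k\}}\big]\ \text{ at } s=a_1s_1+a_2s_2,$$ and, whenever $\mathbb P(K=k)>0$, $M_{\tilde\tau_i\mid K=k}(s_i)=\mathbb E\big[e^{s_i\tilde\tau_i}\mid K=k\big]$ for $i=1,2$. -/

import Mathlib

open MeasureTheory ProbabilityTheory Filter Topology
open scoped NNReal ENNReal Matrix

noncomputable section

namespace CSPH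

/-- A subintensity matrix: nonnegative off-diagonal entries and nonpositive row sums
(so the diagonal entries are nonpositive). -/
def IsSubintensity {V : Type*} [Fintype V] (M : Matrix V V ℝ) : Prop :=
  (∀ i j, i ≠ j → 0 ≤ M i j) ∧ ∀ i, ∑ j, M i j ≤ 0

/-- All states of `V` are transient for the subintensity matrix `M`: the probability
`(e^{tM})_{ij}` of being in state `j` at time `t`, having started from `i`, tends to zero. -/
def IsTransient {V : Type*} [Fintype V] [DecidableEq V] (M : Matrix V V ℝ) : Prop :=
  ∀ i j, Tendsto (fun t : ℝ => NormedSpace.exp (t • M) i j) atTop (𝓝 0)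

/-- The vector `-M 1` of absorption rates of a subintensity matrix. -/
def exitRate {V : Type*} [Fintype V] (M : Matrix V V ℝ) : V → ℝ :=
  -(M *ᵥ 1)

/-- The intensity matrix of the process on `V` together with one absorbing state `Sum.inr ()`,
which is entered at the rates `-M 1`. -/
def withAbsorption {V : Type*} [Fintype V] (M : Matrix V V ℝ) :
    Matrix (V ⊕ Unit) (V ⊕ Unit) ℝ :=
  Matrix.fromBlocks M (Matrix.of fun i _ => exitRate M i) 0 0

/-- The intensity matrix of the joint process up to the common shock. -/
def jointIntensity {E S : Type*} (T : Matrix E E ℝ) (U : Matrix E S ℝ) :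
    Matrix (E ⊕ S) (E ⊕ S) ℝ :=
  Matrix.fromBlocks T U 0 0

/-- The finite-dimensional probability `P(X(t₀) = x₀, …, X(tₙ) = xₙ)`, where
`0 = t₀ ≤ t₁ ≤ … ≤ tₙ`, of a time-homogeneous Markov jump process with initial
distribution `π` and intensity matrix `G`. -/
def pathProb {V : Type*} [Fintype V] [DecidableEq V] (π : V → ℝ) (G : Matrix V V ℝ)
    {n : ℕ} (t : Fin (n + 1) → ℝ≥0) (x : Fin (n + 1) → V) : ℝ :=
  π (x 0) * ∏ i : Fin n,
    NormedSpace.exp (((t i.succ : ℝ) - (t i.castSucc : ℝ)) • G) (x i.castSucc) (x i.succ)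

/-- A jump process on a discrete state space: every `X t` is a random variable, and the paths
are right-continuous, that is, constant on some interval to the right of every time. -/
structure IsJumpProcess {Ω V : Type*} [MeasurableSpace Ω] (X : ℝ≥0 → Ω → V) : Prop where
  measurable : ∀ t x, MeasurableSet {ω | X t ω = x}
  rightContinuous : ∀ ω t, ∀ᶠ u in 𝓝[≥] t, X u ω = X t ω

/-- A Markov jump process with initial distribution `π` and intensity matrix `G`. -/
structure IsMarkovJumpProcess {Ω V : Type*} [MeasurableSpace Ω] [Fintype V] [DecidableEq V]
    (μ : Measure Ω) (X : ℝ≥0 → Ω → V) (π : V → ℝ) (G : Matrix V V ℝ) : Prop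
    extends IsJumpProcess X where
  fdd : ∀ (n : ℕ) (t : Fin (n + 1) → ℝ≥0) (x : Fin (n + 1) → V), Monotone t → t 0 = 0 →
    μ.real {ω | ∀ i, X (t i) ω = x i} = pathProb π G t x

/-- The σ-algebra generated by a process with values in a discrete space. -/
@[reducible] def sigmaOf {Ω V : Type*} (X : ℝ≥0 → Ω → V) : MeasurableSpace Ω :=
  ⨆ t, MeasurableSpace.comap (X t) ⊤

section Model

variable {Ω E S : Type*}

/-- The common-shock time: the first time at which the joint process is not in `E`. -/
def shockTime (J₁₂ : ℝ≥0 → Ω → E ⊕ S) (ω : Ω) : ℝ≥0∞ :=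
  sInf ((fun t : ℝ≥0 => (t : ℝ≥0∞)) '' {t | J₁₂ t ω ∉ Set.range Sum.inl})

/-- The state of the joint process at the common-shock time. -/
def shockState (J₁₂ : ℝ≥0 → Ω → E ⊕ S) (ω : Ω) : E ⊕ S :=
  J₁₂ (shockTime J₁₂ ω).toNNReal ω

/-- The process `J` observed from the common-shock time on. -/
def postShock (J₁₂ : ℝ≥0 → Ω → E ⊕ S) (J : ℝ≥0 → Ω → E ⊕ (S ⊕ Unit)) (t : ℝ≥0) (ω : Ω) :
    E ⊕ (S ⊕ Unit) :=
  J ((shockTime J₁₂ ω).toNNReal + t) ω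

/-- The time from the common shock until `J` is absorbed in the final state. -/
def residualTime (J₁₂ : ℝ≥0 → Ω → E ⊕ S) (J : ℝ≥0 → Ω → E ⊕ (S ⊕ Unit)) (ω : Ω) : ℝ≥0∞ :=
  sInf ((fun t : ℝ≥0 => (t : ℝ≥0∞)) '' {t | postShock J₁₂ J t ω = Sum.inr (Sum.inr ())})

/-- The component `a τ₁₂ + τ̃` of the bivariate vector. Both times are almost surely finite
under the assumptions of the model. -/
def component (a : ℝ) (J₁₂ : ℝ≥0 → Ω → E ⊕ S) (J : ℝ≥0 → Ω → E ⊕ (S ⊕ Unit)) (ω : Ω) : ℝ :=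
  a * (shockTime J₁₂ ω).toReal + (residualTime J₁₂ J ω).toReal

end Model

/-- Admissible parameters of a bivariate common-shock phase-type distribution with pre-shock
states `E` and post-shock states `S`. -/
structure Params (E S : Type*) [Fintype E] [DecidableEq E] [Fintype S] [DecidableEq S] where
  α : E → ℝ
  T : Matrix E E ℝ
  U : Matrix E S ℝ
  Q₁ : Matrix S S ℝ
  Q₂ : Matrix S S ℝ
  a₁ : ℝ
  a₂ : ℝ
  α_mem : α ∈ stdSimplex ℝ E
  T_subintensity : IsSubintensity T
  T_transient : IsTransient T
  U_nonneg : ∀ i k, 0 ≤ U i k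
  rows : T *ᵥ 1 + U *ᵥ 1 = 0
  Q₁_subintensity : IsSubintensity Q₁
  Q₁_transient : IsTransient Q₁
  Q₂_subintensity : IsSubintensity Q₂
  Q₂_transient : IsTransient Q₂
  a₁_pos : 0 < a₁
  a₂_pos : 0 < a₂

/-- The underlying processes of the model. The joint process `J₁₂` on `E ∪ S` is a Markov jump
process started from `α` in `E`. The processes `J₁` and `J₂`, on `E`, `S` and a final state,
coincide with `J₁₂` up to and including the common-shock time. Given the whole process `J₁₂`,
their continuations after the shock are independent Markov jump processes that start from the
shock state and are governed by `Q₁` and `Q₂` until absorption. -/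
structure IsModel {Ω E S : Type*} [MeasurableSpace Ω] [Fintype E] [DecidableEq E] [Fintype S]
    [DecidableEq S] (p : Params E S) (μ : Measure Ω) (J₁₂ : ℝ≥0 → Ω → E ⊕ S)
    (J₁ J₂ : ℝ≥0 → Ω → E ⊕ (S ⊕ Unit)) : Prop where
  joint : IsMarkovJumpProcess μ J₁₂ (Sum.elim p.α 0) (jointIntensity p.T p.U)
  jump₁ : IsJumpProcess J₁
  jump₂ : IsJumpProcess J₂
  agree₁ : ∀ ω (t : ℝ≥0), (t : ℝ≥0∞) ≤ shockTime J₁₂ ω →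
    J₁ t ω = Sum.map id Sum.inl (J₁₂ t ω)
  agree₂ : ∀ ω (t : ℝ≥0), (t : ℝ≥0∞) ≤ shockTime J₁₂ ω →
    J₂ t ω = Sum.map id Sum.inl (J₁₂ t ω)
  post : ∀ (A : Set Ω), MeasurableSet[sigmaOf J₁₂] A → ∀ (k : S)
    (m n : ℕ) (t : Fin (m + 1) → ℝ≥0) (u : Fin (n + 1) → ℝ≥0)
    (x : Fin (m + 1) → S ⊕ Unit) (y : Fin (n + 1) → S ⊕ Unit),
    Monotone t → t 0 = 0 → Monotone u → u 0 = 0 →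
    μ.real (A ∩ {ω | shockState J₁₂ ω = Sum.inr k} ∩
        {ω | ∀ i, postShock J₁₂ J₁ (t i) ω = Sum.inr (x i)} ∩
        {ω | ∀ j, postShock J₁₂ J₂ (u j) ω = Sum.inr (y j)}) =
      μ.real (A ∩ {ω | shockState J₁₂ ω = Sum.inr k}) *
        pathProb (Pi.single (Sum.inl k) 1) (withAbsorption p.Q₁) t x *
        pathProb (Pi.single (Sum.inl k) 1) (withAbsorption p.Q₂) u y

/-- `α (-T - s I)⁻¹ u⁽ᵏ⁾`, where `u⁽ᵏ⁾` is the `k`-th column of `U`. -/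
def shockTransform {E S : Type*} [Fintype E] [DecidableEq E] (α : E → ℝ) (T : Matrix E E ℝ)
    (U : Matrix E S ℝ) (k : S) (s : ℝ) : ℝ :=
  α ⬝ᵥ ((-T - s • (1 : Matrix E E ℝ))⁻¹ *ᵥ (fun i => U i k))

/-- `eₖᵀ (-Q - s I)⁻¹ q`, where `q = -Q 1`. -/
def residualTransform {S : Type*} [Fintype S] [DecidableEq S] (Q : Matrix S S ℝ) (k : S)
    (s : ℝ) : ℝ :=
  Pi.single k 1 ⬝ᵥ ((-Q - s • (1 : Matrix S S ℝ))⁻¹ *ᵥ exitRate Q)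

end CSPH

end

/-! Write τ for the shock time and τ̃₁, τ̃₂ for the residual times. The exponent s₁X₁ + s₂X₂
regroups as (a₁s₁ + a₂s₂)τ + s₁τ̃₁ + s₂τ̃₂. Given K = k these three times are independent
(`IsModel.iIndepFun_cond`), so the expectation over {K = k} factorizes. Transience of T makes the
events {K = k} exhaust almost all of Ω, and the sum over k is the formula.

Each factor is a phase-type transform. If a chain starts in the transient block, the probability of
sitting in an absorbing state k at time t is an entry of the exponential of the block generator. Its
derivative is α e^{tT} u⁽ᵏ⁾, which is therefore the density of the absorption time on that event.
Transience upgrades to exponential decay of e^{tT} (`IsTransient.exists_decay`), so ∫ e^{st} e^{tT}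
dt converges for small |s| and inverts -T - sI (`laplace_mul_eq_one`). The residual times are the
same situation with a unit initial vector and one absorbing state, so
`integrable_and_integral_exp_of_cdf` serves all three factors.

The model is given only through finite-dimensional probabilities. Right-continuity carries almost
sure statements from countably many times to all times; with absorption this identifies {τ ≤ t, K =
k} with {J t = k} up to a null set (`IsMarkovJumpProcess.ae_shock_iff`), and similarly for the
residual times. -/

noncomputable section

namespace CSPH

/-! ### Matrix semigroups: exponential decay and Laplace transform -/

section MatrixExponential

variable {V W : Type*} [Fintype V] [DecidableEq V] [Fintype W] [DecidableEq W]

open scoped Matrix.Norms.Operator in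
lemma hasSum_exp_matrix (A : Matrix V V ℝ) :
    HasSum (fun n : ℕ => ((n.factorial : ℝ)⁻¹) • A ^ n) (NormedSpace.exp A) :=
  NormedSpace.exp_series_hasSum_exp' A

/-- The relation passes to powers and then termwise to the series. With C a block inclusion, an
invariant row or the column of ones, it reads off entries of the exponential of a block matrix
without computing the whole. -/
lemma exp_mul_eq_of_intertwine {A : Matrix V V ℝ} {B : Matrix W W ℝ} {C : Matrix V W ℝ}
    (h : A * C = C * B) : NormedSpace.exp A * C = C * NormedSpace.exp B := by
  have hpow : ∀ n : ℕ, A ^ n * C = C * B ^ n := by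
    intro n
    induction n with
    | zero => simp
    | succ n ih => rw [pow_succ, pow_succ, Matrix.mul_assoc, h, ← Matrix.mul_assoc, ih,
        Matrix.mul_assoc]
  have h1 : HasSum (fun n : ℕ => (((n.factorial : ℝ)⁻¹) • A ^ n) * C) (NormedSpace.exp A * C) :=
    (hasSum_exp_matrix A).map (AddMonoidHom.mk' (fun X : Matrix V V ℝ => X * C)
      fun X Y => Matrix.add_mul X Y C)
      (Continuous.matrix_mul continuous_id continuous_const)
  have h2 : HasSum (fun n : ℕ => C * (((n.factorial : ℝ)⁻¹) • B ^ n)) (C * NormedSpace.exp B) :=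
    (hasSum_exp_matrix B).map (AddMonoidHom.mk' (fun X : Matrix W W ℝ => C * X)
      fun X Y => Matrix.mul_add C X Y)
      (Continuous.matrix_mul continuous_const continuous_id)
  have h3 : (fun n : ℕ => (((n.factorial : ℝ)⁻¹) • A ^ n) * C) =
      fun n : ℕ => C * (((n.factorial : ℝ)⁻¹) • B ^ n) := by
    funext n
    rw [Matrix.smul_mul, Matrix.mul_smul, hpow]
  rw [h3] at h1
  exact h1.unique h2

lemma exp_add_smul (M : Matrix V V ℝ) (s t : ℝ) :
    NormedSpace.exp ((s + t) • M) = NormedSpace.exp (s • M) * NormedSpace.exp (t • M) := by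
  rw [add_smul]
  exact Matrix.exp_add_of_commute _ _ ((Commute.refl M).smul_left s |>.smul_right t)

lemma exp_zero_smul (M : Matrix V V ℝ) : NormedSpace.exp ((0 : ℝ) • M) = 1 := by
  rw [zero_smul, NormedSpace.exp_zero]

open scoped Matrix.Norms.Operator in
lemma hasDerivAt_exp_smul_apply (M : Matrix V V ℝ) (i j : V) (t : ℝ) :
    HasDerivAt (fun t : ℝ => NormedSpace.exp (t • M) i j) ((NormedSpace.exp (t • M) * M) i j) t := by
  have h : HasDerivAt (fun t : ℝ => NormedSpace.exp (t • M)) (NormedSpace.exp (t • M) * M) t :=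
    hasDerivAt_exp_smul_const M t
  have h2 := (LinearMap.toContinuousLinearMap
    (Matrix.entryLinearMap ℝ ℝ i j : Matrix V V ℝ →ₗ[ℝ] ℝ)).hasFDerivAt.comp_hasDerivAt t h
  exact h2

lemma continuous_exp_smul_apply (M : Matrix V V ℝ) (i j : V) :
    Continuous fun t : ℝ => NormedSpace.exp (t • M) i j :=
  continuous_iff_continuousAt.2 fun t => (hasDerivAt_exp_smul_apply M i j t).continuousAt

open scoped Matrix.Norms.Operator in
/-- The entries of the semigroup generated by a transient matrix decay exponentially. -/
lemma IsTransient.exists_decay {M : Matrix V V ℝ} (hM : IsTransient M) :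
    ∃ c : ℝ, 0 < c ∧ ∃ C : ℝ, ∀ t : ℝ, 0 ≤ t → ∀ i j,
      |NormedSpace.exp (t • M) i j| ≤ C * Real.exp (-c * t) := by
  have hlim : Tendsto (fun t : ℝ => NormedSpace.exp (t • M)) atTop (𝓝 0) := by
    refine tendsto_pi_nhds.2 fun i => tendsto_pi_nhds.2 fun j => hM i j
  have hnorm : Tendsto (fun t : ℝ => ‖NormedSpace.exp (t • M)‖) atTop (𝓝 0) := by
    simpa using hlim.norm
  -- One time at which the norm is below 1/2 suffices: by submultiplicativity each further period t₀
  -- halves the bound.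
  obtain ⟨t₀, ht₀, hhalf⟩ : ∃ t₀ : ℝ, 0 < t₀ ∧ ‖NormedSpace.exp (t₀ • M)‖ < 1 / 2 :=
    ((eventually_gt_atTop 0).and (hnorm.eventually_lt_const (by norm_num))).exists
  have hcont : Continuous fun t : ℝ => NormedSpace.exp (t • M) :=
    continuous_pi fun i => continuous_pi fun j => continuous_exp_smul_apply M i j
  obtain ⟨B, hB⟩ := (isCompact_Icc (a := (0 : ℝ)) (b := t₀)).exists_bound_of_continuousOn
    hcont.continuousOn
  have hB0 : 0 ≤ B := (norm_nonneg _).trans (hB 0 ⟨le_rfl, ht₀.le⟩)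
  have hstep : ∀ n : ℕ, ∀ r ∈ Set.Icc 0 t₀,
      ‖NormedSpace.exp ((n * t₀ + r) • M)‖ ≤ (1 / 2) ^ n * B := by
    intro n r hr
    induction n with
    | zero => simpa using hB r hr
    | succ n ih =>
      have : ((n + 1 : ℕ) : ℝ) * t₀ + r = t₀ + (n * t₀ + r) := by push_cast; ring
      rw [this, exp_add_smul]
      calc _ ≤ ‖NormedSpace.exp (t₀ • M)‖ * ‖NormedSpace.exp ((n * t₀ + r) • M)‖ :=
            norm_mul_le _ _
        _ ≤ (1 / 2) * ((1 / 2) ^ n * B) := by gcongr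
        _ = _ := by ring
  have hentry : ∀ (A : Matrix V V ℝ) i j, |A i j| ≤ ‖A‖ := by
    intro A i j
    rw [Matrix.linfty_opNorm_def, ← Real.norm_eq_abs, ← coe_nnnorm, NNReal.coe_le_coe]
    exact (Finset.single_le_sum (f := fun j => ‖A i j‖₊) (fun _ _ => zero_le)
      (Finset.mem_univ j)).trans
        (Finset.le_sup (f := fun i => ∑ j, ‖A i j‖₊) (Finset.mem_univ i))
  -- Halving once per period t₀ is decay at rate log 2 / t₀; the factor 2 pays for rounding t / t₀
  -- down to an integer.
  refine ⟨Real.log 2 / t₀, div_pos (Real.log_pos (by norm_num)) ht₀,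
    2 * B, fun t ht i j => ?_⟩
  have hfloor := Nat.floor_le (div_nonneg ht ht₀.le)
  have hlt := Nat.lt_floor_add_one (t / t₀)
  set n := ⌊t / t₀⌋₊
  have hr : t - n * t₀ ∈ Set.Icc 0 t₀ := by
    rw [le_div_iff₀ ht₀] at hfloor
    rw [div_lt_iff₀ ht₀] at hlt
    constructor <;> nlinarith
  have h1 := hstep n _ hr
  rw [add_sub_cancel] at h1
  have h2 : ((1 : ℝ) / 2) ^ n ≤ 2 * Real.exp (-(Real.log 2 / t₀) * t) := by
    have e1 : ((1 : ℝ) / 2) ^ n = 2 * Real.exp (-(Real.log 2) * (n + 1)) := by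
      have : -(Real.log 2) * ((n : ℝ) + 1) = (n + 1 : ℕ) * (-Real.log 2) := by push_cast; ring
      rw [this, Real.exp_nat_mul, Real.exp_neg, Real.exp_log (by norm_num), pow_succ, inv_eq_one_div]
      ring
    rw [e1]
    have : -(Real.log 2) * ((n : ℝ) + 1) ≤ -(Real.log 2 / t₀) * t := by
      have h3 : Real.log 2 / t₀ * t = Real.log 2 * (t / t₀) := by ring
      have h4 : 0 < Real.log 2 := Real.log_pos (by norm_num)
      nlinarith
    gcongr
  calc |NormedSpace.exp (t • M) i j| ≤ ‖NormedSpace.exp (t • M)‖ := hentry _ i j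
    _ ≤ (2 * Real.exp (-(Real.log 2 / t₀) * t)) * B := h1.trans (by gcongr)
    _ = _ := by ring

lemma integrableOn_exp_mul_of_decay {f : ℝ → ℝ} (hf : Continuous f) {c C s : ℝ}
    (hdecay : ∀ t : ℝ, 0 ≤ t → |f t| ≤ C * Real.exp (-c * t)) (hs : |s| < c) :
    IntegrableOn (fun t => Real.exp (s * t) * f t) (Set.Ioi 0) := by
  have hsc : 0 < c - s := by linarith [le_abs_self s]
  have hg : IntegrableOn (fun t => C * Real.exp (-(c - s) * t)) (Set.Ioi 0) :=
    (exp_neg_integrableOn_Ioi 0 hsc).const_mul C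
  refine hg.mono' (by fun_prop) ?_
  refine (ae_restrict_iff' measurableSet_Ioi).2 (Eventually.of_forall fun t ht => ?_)
  rw [Real.norm_eq_abs, abs_mul, Real.abs_exp]
  calc Real.exp (s * t) * |f t| ≤ Real.exp (s * t) * (C * Real.exp (-c * t)) := by
        gcongr
        exact hdecay t (le_of_lt ht)
    _ = C * Real.exp (-(c - s) * t) := by
        rw [mul_left_comm, ← Real.exp_add]
        ring_nf

lemma tendsto_exp_mul_of_decay {f : ℝ → ℝ} {c C s : ℝ}
    (hdecay : ∀ t : ℝ, 0 ≤ t → |f t| ≤ C * Real.exp (-c * t)) (hs : |s| < c) :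
    Tendsto (fun t => Real.exp (s * t) * f t) atTop (𝓝 0) := by
  have hsc : 0 < c - s := by linarith [le_abs_self s]
  have hg : Tendsto (fun t => C * Real.exp (-((c - s) * t))) atTop (𝓝 0) := by
    simpa using (Real.tendsto_exp_neg_atTop_nhds_zero.comp
      (tendsto_id.const_mul_atTop hsc)).const_mul C
  refine squeeze_zero_norm' ?_ hg
  filter_upwards [eventually_ge_atTop 0] with t ht
  rw [Real.norm_eq_abs, abs_mul, Real.abs_exp]
  calc Real.exp (s * t) * |f t| ≤ Real.exp (s * t) * (C * Real.exp (-c * t)) := by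
        gcongr
        exact hdecay t ht
    _ = C * Real.exp (-((c - s) * t)) := by
        rw [mul_left_comm, ← Real.exp_add]
        ring_nf

/-- The Laplace transform of the semigroup is a left inverse of `-M - s I`. -/
lemma laplace_mul_eq_one {M : Matrix V V ℝ} {c C s : ℝ}
    (hdecay : ∀ t : ℝ, 0 ≤ t → ∀ i j, |NormedSpace.exp (t • M) i j| ≤ C * Real.exp (-c * t))
    (hs : |s| < c) :
    (Matrix.of fun i j => ∫ t in Set.Ioi (0 : ℝ), Real.exp (s * t) * NormedSpace.exp (t • M) i j) *
      (-M - s • (1 : Matrix V V ℝ)) = 1 := by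
  have hint : ∀ i j, IntegrableOn
      (fun t => Real.exp (s * t) * NormedSpace.exp (t • M) i j) (Set.Ioi 0) := fun i j =>
    integrableOn_exp_mul_of_decay (continuous_exp_smul_apply M i j)
      (fun t ht => hdecay t ht i j) hs
  set R : Matrix V V ℝ :=
    Matrix.of fun i j => ∫ t in Set.Ioi (0 : ℝ), Real.exp (s * t) * NormedSpace.exp (t • M) i j
    with hR
  -- Integrate the derivative of e^{st} e^{tM} over (0, ∞): the boundary values are 0 at infinity
  -- and the identity at 0.
  have key : ∀ i j, (R * M) i j + s * R i j = 0 - (1 : Matrix V V ℝ) i j := by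
    intro i j
    have hd : ∀ t ∈ Set.Ici (0 : ℝ),
        HasDerivAt (fun t => Real.exp (s * t) * NormedSpace.exp (t • M) i j)
          (∑ l, (Real.exp (s * t) * NormedSpace.exp (t • M) i l) * M l j +
            s * (Real.exp (s * t) * NormedSpace.exp (t • M) i j)) t := by
      intro t _
      have h1 : HasDerivAt (fun t : ℝ => Real.exp (s * t)) (Real.exp (s * t) * s) t := by
        simpa using ((hasDerivAt_id t).const_mul s).exp
      refine (h1.mul (hasDerivAt_exp_smul_apply M i j t)).congr_deriv ?_
      rw [Matrix.mul_apply, Finset.mul_sum, add_comm]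
      congr 1
      · exact Finset.sum_congr rfl fun l _ => by ring
      · ring
    have hint1 : ∀ l ∈ Finset.univ, IntegrableOn
        (fun t => (Real.exp (s * t) * NormedSpace.exp (t • M) i l) * M l j) (Set.Ioi 0) :=
      fun l _ => (hint i l).mul_const _
    have h := integral_Ioi_of_hasDerivAt_of_tendsto' hd
      ((integrable_finsetSum _ hint1).add ((hint i j).const_mul s))
      (tendsto_exp_mul_of_decay (fun t ht => hdecay t ht i j) hs)
    rw [integral_add (integrable_finsetSum _ hint1) ((hint i j).const_mul s),
      integral_finsetSum _ hint1, integral_const_mul, exp_zero_smul] at h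
    simp only [integral_mul_const, mul_zero, Real.exp_zero, one_mul] at h
    simpa [Matrix.mul_apply, hR] using h
  ext i j
  have := key i j
  simp only [Matrix.mul_sub, Matrix.mul_neg, Matrix.mul_smul, Matrix.mul_one, Matrix.sub_apply,
    Matrix.neg_apply, Matrix.smul_apply, smul_eq_mul]
  linarith

lemma isUnit_neg_sub_smul_one {M : Matrix V V ℝ} {c C s : ℝ}
    (hdecay : ∀ t : ℝ, 0 ≤ t → ∀ i j, |NormedSpace.exp (t • M) i j| ≤ C * Real.exp (-c * t))
    (hs : |s| < c) : IsUnit (-M - s • (1 : Matrix V V ℝ)) :=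
  IsUnit.of_mul_eq_one_right _ (laplace_mul_eq_one hdecay hs)

lemma inv_neg_sub_smul_one {M : Matrix V V ℝ} {c C s : ℝ}
    (hdecay : ∀ t : ℝ, 0 ≤ t → ∀ i j, |NormedSpace.exp (t • M) i j| ≤ C * Real.exp (-c * t))
    (hs : |s| < c) (i j : V) : (-M - s • (1 : Matrix V V ℝ))⁻¹ i j =
      ∫ t in Set.Ioi (0 : ℝ), Real.exp (s * t) * NormedSpace.exp (t • M) i j := by
  rw [Matrix.inv_eq_left_inv (laplace_mul_eq_one hdecay hs), Matrix.of_apply]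

end MatrixExponential

/-! ### Exponentials of generators with an absorbing block -/

section BlockGenerator

variable {V W : Type*} [Fintype V] [DecidableEq V] [Fintype W] [DecidableEq W]
  (T : Matrix V V ℝ) (U : Matrix V W ℝ)

lemma exp_jointIntensity_inl_inl (t : ℝ) (i j : V) :
    NormedSpace.exp (t • jointIntensity T U) (Sum.inl i) (Sum.inl j) =
      NormedSpace.exp (t • T) i j := by
  have h : (t • jointIntensity T U) * Matrix.fromRows (1 : Matrix V V ℝ) (0 : Matrix W V ℝ) =
      Matrix.fromRows (1 : Matrix V V ℝ) (0 : Matrix W V ℝ) * (t • T) := by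
    rw [jointIntensity, Matrix.smul_mul, Matrix.fromBlocks_mul_fromRows, Matrix.fromRows_mul]
    ext (a | a) b <;> simp
  have h2 := congrFun (congrFun (exp_mul_eq_of_intertwine h) (Sum.inl i)) j
  simpa [Matrix.mul_apply, Matrix.one_apply] using h2

lemma exp_jointIntensity_inr (t : ℝ) (k : W) (x : V ⊕ W) :
    NormedSpace.exp (t • jointIntensity T U) (Sum.inr k) x =
      (1 : Matrix (V ⊕ W) (V ⊕ W) ℝ) (Sum.inr k) x := by
  let R : Matrix Unit (V ⊕ W) ℝ :=
    Matrix.of fun _ x => (1 : Matrix (V ⊕ W) (V ⊕ W) ℝ) (Sum.inr k) x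
  have h : (0 : Matrix Unit Unit ℝ) * R = R * (t • jointIntensity T U) := by
    rw [Matrix.zero_mul]
    ext a (b | b) <;> simp [R, Matrix.mul_apply, Matrix.one_apply, jointIntensity]
  have h2 := congrFun (congrFun (exp_mul_eq_of_intertwine h) ()) x
  simpa [R, Matrix.mul_apply, Matrix.one_apply] using h2.symm

lemma sum_exp_jointIntensity (hrow : T *ᵥ 1 + U *ᵥ 1 = 0) (t : ℝ) (x : V ⊕ W) :
    ∑ y, NormedSpace.exp (t • jointIntensity T U) x y = 1 := by
  have h : (t • jointIntensity T U) * (Matrix.of fun _ _ => 1 : Matrix (V ⊕ W) Unit ℝ) =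
      (Matrix.of fun _ _ => 1 : Matrix (V ⊕ W) Unit ℝ) * (0 : Matrix Unit Unit ℝ) := by
    ext (a | a) b
    · have := congrFun hrow a
      simp only [Matrix.mulVec, dotProduct, Pi.add_apply, Pi.one_apply, mul_one,
        Pi.zero_apply] at this
      simp [Matrix.mul_apply, jointIntensity, ← Finset.mul_sum, this]
    · simp [Matrix.mul_apply, jointIntensity]
  have h2 := congrFun (congrFun (exp_mul_eq_of_intertwine h) x) ()
  simpa [Matrix.mul_apply] using h2

lemma hasDerivAt_exp_jointIntensity (t : ℝ) (i : V) (k : W) :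
    HasDerivAt (fun t : ℝ => NormedSpace.exp (t • jointIntensity T U) (Sum.inl i) (Sum.inr k))
      (∑ j, NormedSpace.exp (t • T) i j * U j k) t := by
  convert hasDerivAt_exp_smul_apply (jointIntensity T U) (Sum.inl i) (Sum.inr k) t using 1
  simp [Matrix.mul_apply, exp_jointIntensity_inl_inl]
  simp [jointIntensity]

omit [DecidableEq V] in
-- A residual phase is a shock phase with a single target state, so every fact about the block
-- generator applies to it.
lemma withAbsorption_eq_jointIntensity (Q : Matrix V V ℝ) :
    withAbsorption Q = jointIntensity Q (Matrix.of fun i (_ : Unit) => exitRate Q i) := rfl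

omit [DecidableEq V] in
lemma mulVec_one_add_exitRate (Q : Matrix V V ℝ) :
    Q *ᵥ 1 + (Matrix.of fun i (_ : Unit) => exitRate Q i) *ᵥ 1 = 0 := by
  ext i
  simp [exitRate, Matrix.mulVec, dotProduct]

end BlockGenerator

/-! ### From distribution functions to moment generating functions -/

/-- Nonnegativity of f need not be checked by hand: F is a distribution function on [0, ∞), hence
monotone there. The condition F 0 = 0 rules out an atom at 0, so the density determines the whole
law. -/
lemma eq_withDensity_of_hasDerivAt_cdf {ρ : Measure ℝ} [IsFiniteMeasure ρ] {F f : ℝ → ℝ}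
    (hf : Continuous f) (hderiv : ∀ t, HasDerivAt F (f t) t) (hF0 : F 0 = 0)
    (hneg : ρ (Set.Iio 0) = 0) (hcdf : ∀ t, 0 ≤ t → ρ.real (Set.Iic t) = F t) :
    (∀ t, 0 ≤ t → 0 ≤ f t) ∧
      ρ = (volume.restrict (Set.Ioi 0)).withDensity fun t => ENNReal.ofReal (f t) := by
  have hmono : MonotoneOn F (Set.Ici 0) := by
    intro s hs t ht hst
    rw [← hcdf s hs, ← hcdf t ht]
    exact measureReal_mono (Set.Iic_subset_Iic.2 hst)
  have hnn : ∀ t, 0 ≤ t → 0 ≤ f t := by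
    intro t ht
    -- The derivative is taken within [0, ∞), because monotonicity is not known to the left of 0.
    rw [← (hderiv t).hasDerivWithinAt.derivWithin (uniqueDiffOn_Ici 0 t ht)]
    exact hmono.derivWithin_nonneg
  refine ⟨hnn, Measure.ext_of_Iic _ _ fun t => ?_⟩
  rw [withDensity_apply _ measurableSet_Iic, Measure.restrict_restrict measurableSet_Iic]
  rcases lt_or_ge t 0 with ht | ht
  · have h0 : ρ (Set.Iic t) = 0 := measure_mono_null (Set.Iic_subset_Iio.2 ht) hneg
    rw [h0]
    have : Set.Iic t ∩ Set.Ioi 0 = ∅ := by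
      ext x
      simp only [Set.mem_inter_iff, Set.mem_Iic, Set.mem_Ioi, Set.mem_empty_iff_false, iff_false]
      intro h
      linarith
    simp [this]
  · have hset : Set.Iic t ∩ Set.Ioi 0 = Set.Ioc 0 t := by
      rw [Set.inter_comm, Set.Ioi_inter_Iic]
    have hint : IntervalIntegrable f volume 0 t := hf.intervalIntegrable 0 t
    have hI : ∫ x in Set.Ioc 0 t, f x = F t := by
      rw [← intervalIntegral.integral_of_le ht,
        intervalIntegral.integral_eq_sub_of_hasDerivAt (fun x _ => hderiv x) hint, hF0, sub_zero]
    rw [hset, ← ofReal_integral_eq_lintegral_ofReal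
      ((intervalIntegrable_iff_integrableOn_Ioc_of_le ht).1 hint), hI, ← hcdf t ht,
      ofReal_measureReal]
    exact (ae_restrict_iff' measurableSet_Ioc).2
      (Eventually.of_forall fun x hx => hnn x hx.1.le)

/-- The moment generating function of a law on `[0, ∞)` whose distribution function is that of
the time of absorption of a jump process in a given absorbing state. -/
lemma integrable_and_integral_exp_of_cdf {V W : Type*} [Fintype V] [DecidableEq V] [Fintype W]
    [DecidableEq W] {T : Matrix V V ℝ} {U : Matrix V W ℝ} {α : V → ℝ} {k : W} {c C s : ℝ}
    (hdecay : ∀ t : ℝ, 0 ≤ t → ∀ i j, |NormedSpace.exp (t • T) i j| ≤ C * Real.exp (-c * t))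
    (hs : |s| < c) {ρ : Measure ℝ} [IsFiniteMeasure ρ] (hneg : ρ (Set.Iio 0) = 0)
    (hcdf : ∀ t, 0 ≤ t → ρ.real (Set.Iic t) =
      ∑ i, α i * NormedSpace.exp (t • jointIntensity T U) (Sum.inl i) (Sum.inr k)) :
    Integrable (fun x => Real.exp (s * x)) ρ ∧
      ∫ x, Real.exp (s * x) ∂ρ = shockTransform α T U k s := by
  set f : ℝ → ℝ := fun t => ∑ i, α i * ∑ j, NormedSpace.exp (t • T) i j * U j k with hf_def
  have hf : Continuous f := continuous_finsetSum _ fun i _ => continuous_const.mul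
    (continuous_finsetSum _ fun j _ => (continuous_exp_smul_apply T i j).mul continuous_const)
  have hderiv : ∀ t, HasDerivAt (fun t : ℝ => ∑ i, α i *
      NormedSpace.exp (t • jointIntensity T U) (Sum.inl i) (Sum.inr k)) (f t) t := fun t =>
    HasDerivAt.fun_sum fun i _ => (hasDerivAt_exp_jointIntensity T U t i k).const_mul (α i)
  -- At time 0 the exponential is the identity, whose entries between the two blocks vanish; this is
  -- the absence of an atom.
  obtain ⟨hnn, hρ⟩ := eq_withDensity_of_hasDerivAt_cdf hf hderiv
    (by simp [NormedSpace.exp_zero]) hneg hcdf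
  have hmeas : Measurable fun t => ENNReal.ofReal (f t) := hf.measurable.ennreal_ofReal
  have hcongr : (fun t => (ENNReal.ofReal (f t)).toReal • Real.exp (s * t))
      =ᵐ[volume.restrict (Set.Ioi 0)] fun t => ∑ i, ∑ j,
        (α i * U j k) * (Real.exp (s * t) * NormedSpace.exp (t • T) i j) := by
    refine (ae_restrict_iff' measurableSet_Ioi).2 (Eventually.of_forall fun t ht => ?_)
    dsimp only
    rw [ENNReal.toReal_ofReal (hnn t (le_of_lt ht))]
    simp only [smul_eq_mul, hf_def, Finset.sum_mul, Finset.mul_sum]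
    exact Finset.sum_congr rfl fun i _ => Finset.sum_congr rfl fun j _ => by ring
  have hint : ∀ i j, IntegrableOn
      (fun t => (α i * U j k) * (Real.exp (s * t) * NormedSpace.exp (t • T) i j))
      (Set.Ioi 0) := fun i j =>
    (integrableOn_exp_mul_of_decay (continuous_exp_smul_apply T i j)
      (fun t ht => hdecay t ht i j) hs).const_mul _
  have hlt : ∀ᵐ t ∂volume.restrict (Set.Ioi (0 : ℝ)), ENNReal.ofReal (f t) < ∞ :=
    Eventually.of_forall fun t => ENNReal.ofReal_lt_top
  constructor
  · rw [hρ, integrable_withDensity_iff_integrable_smul' hmeas hlt, integrable_congr hcongr]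
    exact integrable_finsetSum _ fun i _ => integrable_finsetSum _ fun j _ => hint i j
  · rw [hρ, integral_withDensity_eq_integral_toReal_smul hmeas hlt, integral_congr_ae hcongr,
      integral_finsetSum _ fun i _ => integrable_finsetSum _ fun j _ => hint i j]
    simp only [shockTransform, dotProduct, Matrix.mulVec, Finset.mul_sum]
    refine Finset.sum_congr rfl fun i _ => ?_
    rw [integral_finsetSum _ fun j _ => hint i j]
    refine Finset.sum_congr rfl fun j _ => ?_
    rw [integral_const_mul, inv_neg_sub_smul_one hdecay hs]
    ring

/-! ### Hitting times of right-continuous processes -/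

section HittingTime

variable {Ω V : Type*}

/-- The first time at which the process `X` is in `D`. -/
def hit (X : ℝ≥0 → Ω → V) (D : Set V) (ω : Ω) : ℝ≥0∞ :=
  sInf ((fun t : ℝ≥0 => (t : ℝ≥0∞)) '' {t | X t ω ∈ D})

lemma hit_le_of_mem {X : ℝ≥0 → Ω → V} {D : Set V} {ω : Ω} {t : ℝ≥0} (h : X t ω ∈ D) :
    hit X D ω ≤ t :=
  sInf_le ⟨t, h, rfl⟩

lemma exists_Ico_eq {X : ℝ≥0 → Ω → V} {ω : Ω} {t : ℝ≥0}
    (hX : ∀ᶠ u in 𝓝[≥] t, X u ω = X t ω) : ∃ b, t < b ∧ ∀ u, t ≤ u → u < b → X u ω = X t ω := by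
  obtain ⟨b, hb, hsub⟩ := (mem_nhdsGE_iff_exists_Ico_subset' (lt_add_one t)).1 hX
  exact ⟨b, hb, fun u h1 h2 => hsub ⟨h1, h2⟩⟩

/-- The infimum is attained: the path is constant on an interval to the right of it, and that
interval contains a visit to D. -/
lemma mem_of_hit_ne_top {X : ℝ≥0 → Ω → V} {D : Set V} {ω : Ω}
    (hX : ∀ t, ∀ᶠ u in 𝓝[≥] t, X u ω = X t ω) (h : hit X D ω ≠ ∞) :
    X (hit X D ω).toNNReal ω ∈ D := by
  obtain ⟨b, hb, hconst⟩ := exists_Ico_eq (hX (hit X D ω).toNNReal)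
  have hlt : hit X D ω < b := by
    rw [← ENNReal.coe_toNNReal h]
    exact_mod_cast hb
  obtain ⟨_, ⟨u, hu, rfl⟩, hub⟩ := sInf_lt_iff.1 hlt
  rw [← hconst u]
  · exact hu
  · exact ENNReal.toNNReal_mono ENNReal.coe_ne_top (hit_le_of_mem hu)
  · exact ENNReal.coe_lt_coe.1 hub

/-- This replaces an arbitrary time by one from a fixed countable set, which makes the later
measurability and null-set arguments countable. -/
lemma exists_denseSeq_eq {X : ℝ≥0 → Ω → V} {ω : Ω} {t b : ℝ≥0}
    (hX : ∀ᶠ u in 𝓝[≥] t, X u ω = X t ω) (htb : t < b) :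
    ∃ n, t < TopologicalSpace.denseSeq ℝ≥0 n ∧ TopologicalSpace.denseSeq ℝ≥0 n < b ∧
      X (TopologicalSpace.denseSeq ℝ≥0 n) ω = X t ω := by
  obtain ⟨c, hc, hconst⟩ := exists_Ico_eq hX
  obtain ⟨_, ⟨n, rfl⟩, h1, h2⟩ :=
    (TopologicalSpace.denseRange_denseSeq ℝ≥0).exists_between (lt_min htb hc)
  exact ⟨n, h1, h2.trans_le (min_le_left _ _), hconst _ h1.le (h2.trans_le (min_le_right _ _))⟩

lemma measurable_hit {m : MeasurableSpace Ω} {X : ℝ≥0 → Ω → V} {D : Set V}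
    (hX : ∀ ω t, ∀ᶠ u in 𝓝[≥] t, X u ω = X t ω)
    (hD : ∀ t, MeasurableSet {ω | X t ω ∈ D}) : Measurable (hit X D) := by
  refine measurable_of_Iio fun a => ?_
  have : hit X D ⁻¹' Set.Iio a = ⋃ n, ⋃ _ : (TopologicalSpace.denseSeq ℝ≥0 n : ℝ≥0∞) < a,
      {ω | X (TopologicalSpace.denseSeq ℝ≥0 n) ω ∈ D} := by
    ext ω
    simp only [Set.mem_preimage, Set.mem_Iio, Set.mem_iUnion, Set.mem_ofPred_eq, exists_prop]
    constructor
    · intro h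
      obtain ⟨_, ⟨u, hu, rfl⟩, hua⟩ := sInf_lt_iff.1 h
      obtain ⟨b, hub, hba⟩ := ENNReal.lt_iff_exists_nnreal_btwn.1 hua
      obtain ⟨n, -, hnb, hn⟩ := exists_denseSeq_eq (hX ω u) (ENNReal.coe_lt_coe.1 hub)
      refine ⟨n, lt_trans (ENNReal.coe_lt_coe.2 hnb) hba, ?_⟩
      rw [hn]
      exact hu
    · rintro ⟨n, hna, hn⟩
      exact (hit_le_of_mem hn).trans_lt hna
  rw [this]
  exact MeasurableSet.iUnion fun n => MeasurableSet.iUnion fun _ => hD _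

/-- The hypothesis gives one null set per pair of times. Only pairs from the dense sequence are
discarded, and right-continuity carries the conclusion to all pairs. -/
lemma ae_absorbed {m : MeasurableSpace Ω} {μ : Measure Ω} {X : ℝ≥0 → Ω → V} {d : V}
    (hX : ∀ ω t, ∀ᶠ u in 𝓝[≥] t, X u ω = X t ω)
    (hd : ∀ s t, s ≤ t → μ {ω | X s ω = d ∧ X t ω ≠ d} = 0) :
    ∀ᵐ ω ∂μ, ∀ s t, s ≤ t → X s ω = d → X t ω = d := by
  have h : ∀ᵐ ω ∂μ, ∀ n k, TopologicalSpace.denseSeq ℝ≥0 n ≤ TopologicalSpace.denseSeq ℝ≥0 k →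
      X (TopologicalSpace.denseSeq ℝ≥0 n) ω = d → X (TopologicalSpace.denseSeq ℝ≥0 k) ω = d := by
    refine ae_all_iff.2 fun n => ae_all_iff.2 fun k => ?_
    by_cases hnk : TopologicalSpace.denseSeq ℝ≥0 n ≤ TopologicalSpace.denseSeq ℝ≥0 k
    · filter_upwards [measure_eq_zero_iff_ae_notMem.1 (hd _ _ hnk)] with ω hω _ hn
      by_contra hk
      exact hω ⟨hn, hk⟩
    · exact Eventually.of_forall fun ω h => absurd h hnk
  filter_upwards [h] with ω hω s t hst hs
  rcases hst.eq_or_lt with rfl | hst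
  · exact hs
  obtain ⟨n, -, hnt, hn⟩ := exists_denseSeq_eq (hX ω s) hst
  obtain ⟨k, htk, -, hk⟩ := exists_denseSeq_eq (hX ω t) (lt_add_one t)
  rw [← hk]
  exact hω n k (hnt.trans htk).le (hn.trans hs)

lemma IsJumpProcess.measurableSet_randomTime [MeasurableSpace Ω] {X : ℝ≥0 → Ω → V}
    (hX : IsJumpProcess X) {σ : Ω → ℝ≥0} (hσ : Measurable σ) (x : V) :
    MeasurableSet {ω | X (σ ω) ω = x} := by
  -- Approximate σ strictly from the right by times on the grid of mesh 1/(n+1). Each approximation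
  -- takes countably many values, and by right-continuity the process there eventually has its value
  -- at σ.
  let g : ℕ → Ω → ℝ≥0 := fun n ω => (⌊σ ω * (n + 1)⌋₊ + 1) / ((n : ℝ≥0) + 1)
  have hpos : ∀ n : ℕ, (0 : ℝ≥0) < (n : ℝ≥0) + 1 := fun n => by positivity
  have hlow : ∀ n ω, σ ω ≤ g n ω := fun n ω => by
    rw [le_div_iff₀ (hpos n)]
    exact (Nat.lt_floor_add_one _).le
  have hup : ∀ n ω, g n ω ≤ σ ω + 1 / ((n : ℝ≥0) + 1) := fun n ω => by
    have h1 : σ ω = σ ω * (n + 1) / ((n : ℝ≥0) + 1) := by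
      rw [mul_div_assoc, div_self (hpos n).ne', mul_one]
    have h2 : (⌊σ ω * (n + 1)⌋₊ : ℝ≥0) ≤ σ ω * (n + 1) := Nat.floor_le zero_le
    calc g n ω ≤ (σ ω * (n + 1) + 1) / ((n : ℝ≥0) + 1) := by
          dsimp only [g]
          gcongr
      _ = σ ω + 1 / ((n : ℝ≥0) + 1) := by rw [add_div, ← h1]
  have hlim : ∀ ω, Tendsto (fun n => g n ω) atTop (𝓝[≥] (σ ω)) := fun ω => by
    refine tendsto_nhdsWithin_iff.2 ⟨?_, Eventually.of_forall fun n => hlow n ω⟩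
    refine tendsto_of_tendsto_of_tendsto_of_le_of_le tendsto_const_nhds ?_
      (fun n => hlow n ω) (fun n => hup n ω)
    have h0 : Tendsto (fun n : ℕ => 1 / ((n : ℝ≥0) + 1)) atTop (𝓝 0) := by
      rw [← NNReal.tendsto_coe]
      simpa using tendsto_one_div_add_atTop_nhds_zero_nat (𝕜 := ℝ)
    simpa using h0.const_add (σ ω)
  have hev : ∀ ω, ∀ᶠ n in atTop, X (g n ω) ω = X (σ ω) ω := fun ω =>
    (hlim ω).eventually (hX.rightContinuous ω (σ ω))
  have hset : {ω | X (σ ω) ω = x} = {ω | ∀ᶠ n in atTop, X (g n ω) ω = x} := by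
    ext ω
    constructor
    · intro h
      exact (hev ω).mono fun n hn => hn.trans h
    · intro h
      obtain ⟨n, h1, h2⟩ := ((hev ω).and h).exists
      exact h1.symm.trans h2
  have hg : ∀ n, MeasurableSet {ω | X (g n ω) ω = x} := fun n => by
    have : {ω | X (g n ω) ω = x} = ⋃ k : ℕ, {ω | ⌊σ ω * (n + 1)⌋₊ = k} ∩
        {ω | X ((k + 1) / ((n : ℝ≥0) + 1)) ω = x} := by
      ext ω
      simp [g]
    rw [this]
    refine MeasurableSet.iUnion fun k => MeasurableSet.inter ?_ (hX.measurable _ _)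
    exact (Nat.measurable_floor.comp (hσ.mul_const _)) (measurableSet_singleton k)
  rw [hset]
  simp only [eventually_atTop, Set.ofPred_exists, Set.ofPred_forall]
  exact MeasurableSet.iUnion fun N => MeasurableSet.iInter fun n => MeasurableSet.iInter fun _ => hg n

end HittingTime

/-! ### Path probabilities at up to three times -/

section PathProb

variable {V : Type*} [Fintype V] [DecidableEq V] (π : V → ℝ) (G : Matrix V V ℝ)

lemma pathProb_zero (t : ℝ≥0) (x : V) : pathProb π G ![t] ![x] = π x := by
  simp [pathProb]

lemma pathProb_one (t : ℝ≥0) (x y : V) :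
    pathProb π G ![0, t] ![x, y] = π x * NormedSpace.exp ((t : ℝ) • G) x y := by
  simp [pathProb]

lemma pathProb_two (s t : ℝ≥0) (x y z : V) :
    pathProb π G ![0, s, t] ![x, y, z] = π x *
      (NormedSpace.exp ((s : ℝ) • G) x y * NormedSpace.exp (((t : ℝ) - s) • G) y z) := by
  simp [pathProb, Fin.prod_univ_two]

end PathProb

lemma monotone_vec_two (t : ℝ≥0) : Monotone ![0, t] := by
  refine Fin.monotone_iff_le_succ.2 fun i => ?_
  fin_cases i
  simp

lemma monotone_vec_three {s t : ℝ≥0} (h : s ≤ t) : Monotone ![0, s, t] := by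
  refine Fin.monotone_iff_le_succ.2 fun i => ?_
  fin_cases i
  · simp
  · simpa using h

/-! ### The common-shock time and state -/

lemma shockTime_eq_hit {Ω E S : Type*} (J : ℝ≥0 → Ω → E ⊕ S) :
    shockTime J = hit J (Set.range Sum.inl)ᶜ := rfl

/-- An infinite shock time is read as 0 by `toNNReal`, so the shock state would be the state at time
0. If that lay in `S`, the shock time would be 0. Hence {K = k} contains no spurious outcomes. -/
lemma shockTime_ne_top_of_shockState {Ω E S : Type*} {J : ℝ≥0 → Ω → E ⊕ S} {ω : Ω} {k : S}
    (hk : shockState J ω = Sum.inr k) : shockTime J ω ≠ ∞ := by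
  intro htop
  have h0 : J 0 ω = Sum.inr k := by simpa [shockState, htop] using hk
  have := hit_le_of_mem (X := J) (D := (Set.range Sum.inl)ᶜ) (ω := ω) (t := 0) (by simp [h0])
  rw [← shockTime_eq_hit, htop] at this
  simp at this

lemma IsJumpProcess.measurable_shockTime
    {Ω E S : Type*} [Fintype E] [MeasurableSpace Ω] {J : ℝ≥0 → Ω → E ⊕ S} (hJ : IsJumpProcess J) :
    Measurable (shockTime J) := by
  rw [shockTime_eq_hit]
  refine measurable_hit hJ.rightContinuous fun t => ?_
  have : {ω | J t ω ∈ (Set.range Sum.inl)ᶜ} = (⋃ e : E, {ω | J t ω = Sum.inl e})ᶜ := by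
    ext ω
    rcases h : J t ω with e | k <;> simp [h]
  rw [this]
  exact (MeasurableSet.iUnion fun e => hJ.measurable t _).compl

/-- Needed because the conditional independence in `IsModel.post` is stated for events of the
σ-algebra generated by the joint process. -/
lemma IsJumpProcess.measurable_sigmaOf_shockTime
    {Ω E S : Type*} [MeasurableSpace Ω] {J : ℝ≥0 → Ω → E ⊕ S} (hJ : IsJumpProcess J) :
    Measurable[sigmaOf J] (shockTime J) := by
  rw [shockTime_eq_hit]
  refine @measurable_hit _ _ (sigmaOf J) _ _ hJ.rightContinuous fun t => ?_
  exact le_iSup (fun t => MeasurableSpace.comap (J t) ⊤) t _ ⟨(Set.range Sum.inl)ᶜ, trivial, rfl⟩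

lemma IsJumpProcess.measurableSet_shockState
    {Ω E S : Type*} [Fintype E] [MeasurableSpace Ω] {J : ℝ≥0 → Ω → E ⊕ S} (hJ : IsJumpProcess J)
    (x : E ⊕ S) :
    MeasurableSet {ω | shockState J ω = x} :=
  hJ.measurableSet_randomTime hJ.measurable_shockTime.ennreal_toNNReal x

section Shock

variable {Ω E S : Type*} [Fintype E] [DecidableEq E] [Fintype S] [DecidableEq S]
  [MeasurableSpace Ω] {μ : Measure Ω} {J : ℝ≥0 → Ω → E ⊕ S} {α : E → ℝ}
  {T : Matrix E E ℝ} {U : Matrix E S ℝ} [IsProbabilityMeasure μ]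

lemma IsMarkovJumpProcess.measureReal_eq
    (hJ : IsMarkovJumpProcess μ J (Sum.elim α 0) (jointIntensity T U)) (t : ℝ≥0) (y : E ⊕ S) :
    μ.real {ω | J t ω = y} =
      ∑ i, α i * NormedSpace.exp ((t : ℝ) • jointIntensity T U) (Sum.inl i) y := by
  have hset : {ω | J t ω = y} = ⋃ x, {ω | J 0 ω = x} ∩ {ω | J t ω = y} := by
    ext ω
    simp
  have hpair : ∀ x, μ.real ({ω | J 0 ω = x} ∩ {ω | J t ω = y}) =
      (Sum.elim α 0 : E ⊕ S → ℝ) x * NormedSpace.exp ((t : ℝ) • jointIntensity T U) x y := by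
    intro x
    rw [← pathProb_one, ← hJ.fdd 1 ![0, t] ![x, y] (monotone_vec_two t) rfl]
    congr 1
    ext ω
    simp [Fin.forall_fin_two]
  rw [hset, measureReal_iUnion_fintype]
  · simp [hpair, Fintype.sum_sum_type]
  · intro x x' hxx'
    refine Set.disjoint_left.2 fun ω h h' => hxx' (h.1.symm.trans h'.1)
  · exact fun x => (hJ.measurable 0 x).inter (hJ.measurable t y)

/-- The row of an absorbing state in the exponential is that of the identity, so requiring the state
again at a later time does not change the probability. -/
lemma IsMarkovJumpProcess.measure_leave_inr
    (hJ : IsMarkovJumpProcess μ J (Sum.elim α 0) (jointIntensity T U)) {s t : ℝ≥0} (hst : s ≤ t)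
    (k : S) : μ {ω | J s ω = Sum.inr k ∧ J t ω ≠ Sum.inr k} = 0 := by
  -- Path probabilities always include time 0, hence the splitting by initial state.
  have hset : {ω | J s ω = Sum.inr k ∧ J t ω ≠ Sum.inr k} =
      ⋃ x, ({ω | ∀ i, J (![0, s] i) ω = ![x, Sum.inr k] i} \
        {ω | ∀ i, J (![0, s, t] i) ω = ![x, Sum.inr k, Sum.inr k] i}) := by
    ext ω
    simp only [Set.mem_ofPred_eq, Set.mem_iUnion, Set.mem_sdiff, Fin.forall_fin_succ,
      Matrix.cons_val_zero, Matrix.cons_val_succ, IsEmpty.forall_iff]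
    simp +contextual
  rw [hset, measure_iUnion_null_iff]
  intro x
  rw [← measureReal_eq_zero_iff, measureReal_sdiff]
  · rw [hJ.fdd 1 _ _ (monotone_vec_two s) rfl, hJ.fdd 2 _ _ (monotone_vec_three hst) rfl,
      pathProb_one, pathProb_two, exp_jointIntensity_inr, Matrix.one_apply_eq, mul_one, sub_self]
  · intro ω h i
    fin_cases i
    · exact h 0
    · exact h 1
  · simp only [Set.ofPred_forall]
    exact MeasurableSet.iInter fun i => hJ.measurable _ _

lemma IsMarkovJumpProcess.ae_absorbed_inr
    (hJ : IsMarkovJumpProcess μ J (Sum.elim α 0) (jointIntensity T U)) :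
    ∀ᵐ ω ∂μ, ∀ k s t, s ≤ t → J s ω = Sum.inr k → J t ω = Sum.inr k :=
  ae_all_iff.2 fun k => ae_absorbed hJ.rightContinuous fun _ _ hst => hJ.measure_leave_inr hst k

/-- Once in k the process stays there, so its position at t reveals whether the shock has occurred
and where. This turns one-time marginals into the distribution function of the shock time on {K =
k}. -/
lemma IsMarkovJumpProcess.ae_shock_iff
    (hJ : IsMarkovJumpProcess μ J (Sum.elim α 0) (jointIntensity T U)) (t : ℝ≥0) (k : S) :
    ∀ᵐ ω ∂μ, (shockState J ω = Sum.inr k ∧ shockTime J ω ≤ t) ↔ J t ω = Sum.inr k := by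
  filter_upwards [hJ.ae_absorbed_inr] with ω hω
  constructor
  · rintro ⟨hk, ht⟩
    exact hω k _ t (ENNReal.toNNReal_mono ENNReal.coe_ne_top ht) hk
  · intro hk
    have hle : shockTime J ω ≤ t :=
      hit_le_of_mem (X := J) (D := (Set.range Sum.inl)ᶜ) (by simp [hk])
    have hne : shockTime J ω ≠ ∞ := ne_top_of_le_ne_top ENNReal.coe_ne_top hle
    have hmem := mem_of_hit_ne_top (X := J) (D := (Set.range Sum.inl)ᶜ) (hJ.rightContinuous ω) hne
    refine ⟨?_, hle⟩
    rw [← shockTime_eq_hit] at hmem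
    rcases h : J (shockTime J ω).toNNReal ω with e | k'
    · exact absurd ⟨e, h.symm⟩ hmem
    · have := hω k' _ t (ENNReal.toNNReal_mono ENNReal.coe_ne_top hle) h
      rw [hk] at this
      rw [shockState, h, this]

/-- Without a shock the process is in `E` at every time t, an event whose probability tends to 0 by
transience. -/
lemma IsMarkovJumpProcess.ae_shockTime_ne_top (hT : IsTransient T)
    (hJ : IsMarkovJumpProcess μ J (Sum.elim α 0) (jointIntensity T U)) :
    ∀ᵐ ω ∂μ, shockTime J ω ≠ ∞ := by
  have hlim : Tendsto (fun t : ℝ≥0 => ∑ j : E, μ.real {ω | J t ω = Sum.inl j}) atTop (𝓝 0) := by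
    simp only [hJ.measureReal_eq, exp_jointIntensity_inl_inl]
    have : Tendsto (fun t : ℝ => ∑ j : E, ∑ i, α i * NormedSpace.exp (t • T) i j) atTop (𝓝 0) := by
      simpa using tendsto_finsetSum Finset.univ fun j _ =>
        tendsto_finsetSum Finset.univ fun i _ => (hT i j).const_mul (α i)
    exact this.comp (NNReal.tendsto_coe_atTop.2 tendsto_id)
  have hle : ∀ t : ℝ≥0, μ.real {ω | shockTime J ω = ∞} ≤
      ∑ j : E, μ.real {ω | J t ω = Sum.inl j} := by
    intro t
    refine (measureReal_mono ?_).trans (measureReal_iUnion_fintype_le _)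
    intro ω hω
    by_contra hcon
    have : shockTime J ω ≤ t := by
      refine hit_le_of_mem (X := J) (D := (Set.range Sum.inl)ᶜ) ?_
      rintro ⟨e, he⟩
      exact hcon (Set.mem_iUnion.2 ⟨e, he.symm⟩)
    rw [hω] at this
    simp at this
  have h0 : μ.real {ω | shockTime J ω = ∞} = 0 :=
    le_antisymm (ge_of_tendsto' hlim hle) measureReal_nonneg
  rw [measureReal_eq_zero_iff] at h0
  exact measure_eq_zero_iff_ae_notMem.1 h0

lemma IsMarkovJumpProcess.exists_shockState (hT : IsTransient T)
    (hJ : IsMarkovJumpProcess μ J (Sum.elim α 0) (jointIntensity T U)) :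
    ∀ᵐ ω ∂μ, ∃ k, shockState J ω = Sum.inr k := by
  filter_upwards [hJ.ae_shockTime_ne_top hT] with ω hω
  have hmem := mem_of_hit_ne_top (X := J) (D := (Set.range Sum.inl)ᶜ) (hJ.rightContinuous ω) hω
  rw [← shockTime_eq_hit] at hmem
  rcases h : J (shockTime J ω).toNNReal ω with e | k
  · exact absurd ⟨e, h.symm⟩ hmem
  · exact ⟨k, h⟩

/-- The moment generating function of the shock time on the event that the shock state is `k`. -/
lemma IsMarkovJumpProcess.integral_exp_shockTime
    (hJ : IsMarkovJumpProcess μ J (Sum.elim α 0) (jointIntensity T U)) {c C s : ℝ}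
    (hdecay : ∀ t : ℝ, 0 ≤ t → ∀ i j, |NormedSpace.exp (t • T) i j| ≤ C * Real.exp (-c * t))
    (hs : |s| < c) (k : S) :
    IntegrableOn (fun ω => Real.exp (s * (shockTime J ω).toReal))
        {ω | shockState J ω = Sum.inr k} μ ∧
      ∫ ω in {ω | shockState J ω = Sum.inr k}, Real.exp (s * (shockTime J ω).toReal) ∂μ =
        shockTransform α T U k s := by
  have hB := hJ.measurableSet_shockState (Sum.inr k)
  have hmeas : Measurable fun ω => (shockTime J ω).toReal := hJ.measurable_shockTime.ennreal_toReal
  set ρ := (μ.restrict {ω | shockState J ω = Sum.inr k}).map fun ω => (shockTime J ω).toReal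
    with hρ
  have hneg : ρ (Set.Iio 0) = 0 := by
    rw [hρ, Measure.map_apply hmeas measurableSet_Iio]
    convert measure_empty (μ := μ.restrict {ω | shockState J ω = Sum.inr k})
    ext ω
    simp
  have hcdf : ∀ t, 0 ≤ t → ρ.real (Set.Iic t) =
      ∑ i, α i * NormedSpace.exp (t • jointIntensity T U) (Sum.inl i) (Sum.inr k) := by
    intro t ht
    lift t to ℝ≥0 using ht
    rw [← hJ.measureReal_eq, hρ, map_measureReal_apply hmeas measurableSet_Iic,
      measureReal_restrict_apply (hmeas measurableSet_Iic)]
    refine measureReal_congr ?_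
    filter_upwards [hJ.ae_shock_iff t k] with ω hω
    refine propext (Iff.trans ?_ hω)
    change ((shockTime J ω).toReal ≤ t ∧ shockState J ω = Sum.inr k) ↔ _
    rw [and_comm]
    refine and_congr_right fun hk => ?_
    rw [← ENNReal.coe_toReal, ENNReal.toReal_le_toReal (shockTime_ne_top_of_shockState hk)
      ENNReal.coe_ne_top]
  have h := integrable_and_integral_exp_of_cdf hdecay hs hneg hcdf
  have hexp : Measurable fun x : ℝ => Real.exp (s * x) := by fun_prop
  rw [hρ, integrable_map_measure hexp.aestronglyMeasurable hmeas.aemeasurable,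
    integral_map hmeas.aemeasurable hexp.aestronglyMeasurable] at h
  exact h

end Shock

/-! ### The residual times given the shock state -/

lemma residualTime_eq_hit {Ω E S : Type*} (J₁₂ : ℝ≥0 → Ω → E ⊕ S)
    (J : ℝ≥0 → Ω → E ⊕ (S ⊕ Unit)) :
    residualTime J₁₂ J = hit (postShock J₁₂ J) {Sum.inr (Sum.inr ())} := rfl

lemma cond_measureReal_apply {Ω : Type*} [MeasurableSpace Ω] {μ : Measure Ω} {B : Set Ω}
    (hB : MeasurableSet B) (A : Set Ω) :
    (μ[|B]).real A = (μ.real B)⁻¹ * μ.real (B ∩ A) := by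
  rw [measureReal_def, cond_apply hB, ENNReal.toReal_mul, ENNReal.toReal_inv, ← measureReal_def,
    ← measureReal_def]

section Residual

variable {Ω E S : Type*} [MeasurableSpace Ω] [Fintype E] [DecidableEq E] [Fintype S]
  [DecidableEq S] {p : Params E S} {μ : Measure Ω} {J₁₂ : ℝ≥0 → Ω → E ⊕ S}
  {J₁ J₂ : ℝ≥0 → Ω → E ⊕ (S ⊕ Unit)}

/-- The parameters with the roles of the two components exchanged. -/
def Params.swap (p : Params E S) : Params E S where
  α := p.α
  T := p.T
  U := p.U
  Q₁ := p.Q₂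
  Q₂ := p.Q₁
  a₁ := p.a₂
  a₂ := p.a₁
  α_mem := p.α_mem
  T_subintensity := p.T_subintensity
  T_transient := p.T_transient
  U_nonneg := p.U_nonneg
  rows := p.rows
  Q₁_subintensity := p.Q₂_subintensity
  Q₁_transient := p.Q₂_transient
  Q₂_subintensity := p.Q₁_subintensity
  Q₂_transient := p.Q₁_transient
  a₁_pos := p.a₂_pos
  a₂_pos := p.a₁_pos

/-- The model is symmetric in its two components, so facts are proved for `J₁` and transferred to
`J₂`. -/
lemma IsModel.swap (h : IsModel p μ J₁₂ J₁ J₂) : IsModel p.swap μ J₁₂ J₂ J₁ where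
  joint := h.joint
  jump₁ := h.jump₂
  jump₂ := h.jump₁
  agree₁ := h.agree₂
  agree₂ := h.agree₁
  post := by
    intro A hA k m n t u x y ht ht0 hu hu0
    rw [Set.inter_right_comm, h.post A hA k n m u t y x hu hu0 ht ht0, mul_right_comm]
    rfl

/-- The probability of being absorbed within time `t` after a start in `k`. -/
def absorbedProb (Q : Matrix S S ℝ) (k : S) (t : ℝ) : ℝ :=
  NormedSpace.exp (t • withAbsorption Q) (Sum.inl k) (Sum.inr ())

/-- Rows of the full semigroup sum to 1, and the mass left in the transient states vanishes. -/
lemma tendsto_absorbedProb {Q : Matrix S S ℝ} (hQ : IsTransient Q) (k : S) :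
    Tendsto (absorbedProb Q k) atTop (𝓝 1) := by
  have h : ∀ t : ℝ, absorbedProb Q k t = 1 - ∑ j, NormedSpace.exp (t • Q) k j := by
    intro t
    have := sum_exp_jointIntensity Q _ (mulVec_one_add_exitRate Q) t (Sum.inl k)
    rw [Fintype.sum_sum_type] at this
    simp only [exp_jointIntensity_inl_inl, Finset.univ_unique, Finset.sum_singleton] at this
    rw [absorbedProb, withAbsorption_eq_jointIntensity]
    exact eq_sub_of_add_eq' this
  have hlim : Tendsto (fun t : ℝ => 1 - ∑ j, NormedSpace.exp (t • Q) k j) atTop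
      (𝓝 (1 - ∑ _j : S, 0)) :=
    (tendsto_finsetSum Finset.univ fun j _ => hQ k j).const_sub 1
  rw [funext h]
  simpa using hlim

lemma IsModel.postShock_zero₁ (h : IsModel p μ J₁₂ J₁ J₂) {ω : Ω} {k : S}
    (hk : shockState J₁₂ ω = Sum.inr k) : postShock J₁₂ J₁ 0 ω = Sum.inr (Sum.inl k) := by
  rw [postShock, add_zero, h.agree₁ ω _ ENNReal.coe_toNNReal_le_self]
  rw [shockState] at hk
  rw [hk]
  rfl

lemma IsModel.rightContinuous_postShock (h : IsModel p μ J₁₂ J₁ J₂) (ω : Ω) (t : ℝ≥0) :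
    ∀ᶠ u in 𝓝[≥] t, postShock J₁₂ J₁ u ω = postShock J₁₂ J₁ t ω := by
  have hlim : Tendsto (fun u => (shockTime J₁₂ ω).toNNReal + u) (𝓝[≥] t)
      (𝓝[≥] ((shockTime J₁₂ ω).toNNReal + t)) := by
    refine tendsto_nhdsWithin_iff.2 ⟨?_, ?_⟩
    · exact ((continuous_const.add continuous_id).tendsto t).mono_left nhdsWithin_le_nhds
    · filter_upwards [self_mem_nhdsWithin] with u hu
      exact add_le_add_right (Set.mem_Ici.1 hu) _
  exact hlim.eventually (h.jump₁.rightContinuous ω _)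

lemma IsModel.measurableSet_postShock (h : IsModel p μ J₁₂ J₁ J₂) (t : ℝ≥0)
    (x : E ⊕ (S ⊕ Unit)) : MeasurableSet {ω | postShock J₁₂ J₁ t ω = x} :=
  h.jump₁.measurableSet_randomTime
    (h.joint.measurable_shockTime.ennreal_toNNReal.add_const t) x

lemma IsModel.measurable_residualTime (h : IsModel p μ J₁₂ J₁ J₂) :
    Measurable (residualTime J₁₂ J₁) := by
  rw [residualTime_eq_hit]
  exact measurable_hit h.rightContinuous_postShock fun t => h.measurableSet_postShock t _

lemma IsModel.measureReal_postShock_inter (h : IsModel p μ J₁₂ J₁ J₂) {A : Set Ω}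
    (hA : MeasurableSet[sigmaOf J₁₂] A) (k : S) (t u : ℝ≥0) :
    μ.real (A ∩ {ω | shockState J₁₂ ω = Sum.inr k} ∩
        {ω | postShock J₁₂ J₁ t ω = Sum.inr (Sum.inr ())} ∩
        {ω | postShock J₁₂ J₂ u ω = Sum.inr (Sum.inr ())}) =
      μ.real (A ∩ {ω | shockState J₁₂ ω = Sum.inr k}) *
        absorbedProb p.Q₁ k t * absorbedProb p.Q₂ k u := by
  have hpost := h.post A hA k 1 1 ![0, t] ![0, u] ![Sum.inl k, Sum.inr ()]
    ![Sum.inl k, Sum.inr ()] (monotone_vec_two t) rfl (monotone_vec_two u) rfl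
  rw [pathProb_one, pathProb_one, Pi.single_eq_same, one_mul, one_mul] at hpost
  rw [absorbedProb, absorbedProb, ← hpost]
  congr 1
  ext ω
  have h1 := h.postShock_zero₁ (ω := ω) (k := k)
  have h2 := h.swap.postShock_zero₁ (ω := ω) (k := k)
  simp only [Set.mem_inter_iff, Set.mem_ofPred_eq, Fin.forall_fin_succ, Matrix.cons_val_zero,
    Matrix.cons_val_succ, IsEmpty.forall_iff]
  tauto

lemma IsModel.measureReal_postShock (h : IsModel p μ J₁₂ J₁ J₂) (k : S) (m : ℕ)
    (t : Fin (m + 1) → ℝ≥0) (x : Fin (m + 1) → S ⊕ Unit) (ht : Monotone t) (ht0 : t 0 = 0) :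
    μ.real ({ω | shockState J₁₂ ω = Sum.inr k} ∩
        {ω | ∀ i, postShock J₁₂ J₁ (t i) ω = Sum.inr (x i)}) =
      μ.real {ω | shockState J₁₂ ω = Sum.inr k} *
        pathProb (Pi.single (Sum.inl k) 1) (withAbsorption p.Q₁) t x := by
  -- The second component is marginalized out by observing it only at time 0, where it equals k on
  -- this event anyway.
  have hpost := h.post Set.univ MeasurableSet.univ k m 0 t ![0] x ![Sum.inl k] ht ht0
    (fun i j _ => by fin_cases i; fin_cases j; rfl) rfl
  rw [pathProb_zero, Pi.single_eq_same, mul_one, Set.univ_inter] at hpost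
  rw [← hpost]
  congr 1
  ext ω
  simp only [Set.mem_inter_iff, Set.mem_ofPred_eq]
  exact ⟨fun hω => ⟨hω, fun j => by
    fin_cases j
    exact h.swap.postShock_zero₁ hω.1⟩, fun hω => hω.1⟩

lemma IsModel.measureReal_postShock_absorbed (h : IsModel p μ J₁₂ J₁ J₂) (k : S) (t : ℝ≥0) :
    μ.real ({ω | shockState J₁₂ ω = Sum.inr k} ∩
        {ω | postShock J₁₂ J₁ t ω = Sum.inr (Sum.inr ())}) =
      μ.real {ω | shockState J₁₂ ω = Sum.inr k} * absorbedProb p.Q₁ k t := by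
  have hpost := h.measureReal_postShock k 1 ![0, t] ![Sum.inl k, Sum.inr ()]
    (monotone_vec_two t) rfl
  rw [pathProb_one, Pi.single_eq_same, one_mul] at hpost
  rw [absorbedProb, ← hpost]
  congr 1
  ext ω
  have h0 := h.postShock_zero₁ (ω := ω) (k := k)
  simp only [Set.mem_inter_iff, Set.mem_ofPred_eq, Fin.forall_fin_succ, Matrix.cons_val_zero,
    Matrix.cons_val_succ, IsEmpty.forall_iff]
  tauto

variable [IsProbabilityMeasure μ]

lemma IsModel.ae_absorbed_postShock (h : IsModel p μ J₁₂ J₁ J₂) (k : S) :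
    ∀ᵐ ω ∂μ.restrict {ω | shockState J₁₂ ω = Sum.inr k}, ∀ s t, s ≤ t →
      postShock J₁₂ J₁ s ω = Sum.inr (Sum.inr ()) →
        postShock J₁₂ J₁ t ω = Sum.inr (Sum.inr ()) := by
  have hB := h.joint.measurableSet_shockState (Sum.inr k)
  refine ae_absorbed h.rightContinuous_postShock fun s t hst => ?_
  rw [Measure.restrict_apply' hB]
  have hset : {ω | postShock J₁₂ J₁ s ω = Sum.inr (Sum.inr ()) ∧
        postShock J₁₂ J₁ t ω ≠ Sum.inr (Sum.inr ())} ∩ {ω | shockState J₁₂ ω = Sum.inr k} =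
      ({ω | shockState J₁₂ ω = Sum.inr k} ∩
        {ω | ∀ i, postShock J₁₂ J₁ (![0, s] i) ω = Sum.inr (![Sum.inl k, Sum.inr ()] i)}) \
      ({ω | shockState J₁₂ ω = Sum.inr k} ∩
        {ω | ∀ i, postShock J₁₂ J₁ (![0, s, t] i) ω =
          Sum.inr (![Sum.inl k, Sum.inr (), Sum.inr ()] i)}) := by
    ext ω
    have h0 := h.postShock_zero₁ (ω := ω) (k := k)
    simp only [Set.mem_ofPred_eq, Set.mem_inter_iff, Set.mem_sdiff, Fin.forall_fin_succ,
      Matrix.cons_val_zero, Matrix.cons_val_succ, IsEmpty.forall_iff]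
    tauto
  rw [hset, ← measureReal_eq_zero_iff, measureReal_sdiff]
  · rw [h.measureReal_postShock k 1 _ _ (monotone_vec_two s) rfl,
      h.measureReal_postShock k 2 _ _ (monotone_vec_three hst) rfl,
      pathProb_one, pathProb_two, withAbsorption_eq_jointIntensity, exp_jointIntensity_inr,
      Matrix.one_apply_eq, mul_one, sub_self]
  · rintro ω ⟨hk, hω⟩
    refine ⟨hk, fun i => ?_⟩
    fin_cases i
    · exact hω 0
    · exact hω 1
  · simp only [Set.ofPred_forall]
    exact hB.inter (MeasurableSet.iInter fun i => h.measurableSet_postShock _ _)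

lemma IsModel.ae_residualTime_le_iff (h : IsModel p μ J₁₂ J₁ J₂) (k : S) (t : ℝ≥0) :
    ∀ᵐ ω ∂μ.restrict {ω | shockState J₁₂ ω = Sum.inr k},
      residualTime J₁₂ J₁ ω ≤ t ↔ postShock J₁₂ J₁ t ω = Sum.inr (Sum.inr ()) := by
  filter_upwards [h.ae_absorbed_postShock k] with ω hω
  constructor
  · intro ht
    have hmem := mem_of_hit_ne_top (D := {Sum.inr (Sum.inr ())}) (h.rightContinuous_postShock ω)
      (ne_top_of_le_ne_top ENNReal.coe_ne_top ht)
    exact hω _ t (ENNReal.toNNReal_mono ENNReal.coe_ne_top ht) hmem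
  · exact fun ht => hit_le_of_mem (D := {Sum.inr (Sum.inr ())}) ht

/-- On {K = k}, an infinite residual time forces non-absorption at every t, whose probability tends
to 0. -/
lemma IsModel.ae_residualTime_ne_top (h : IsModel p μ J₁₂ J₁ J₂) (k : S) :
    ∀ᵐ ω ∂μ.restrict {ω | shockState J₁₂ ω = Sum.inr k}, residualTime J₁₂ J₁ ω ≠ ∞ := by
  set B := {ω | shockState J₁₂ ω = Sum.inr k} with hB_def
  have hB : MeasurableSet B := h.joint.measurableSet_shockState (Sum.inr k)
  have hlim : Tendsto (fun t : ℝ≥0 => μ.real B - μ.real B * absorbedProb p.Q₁ k t) atTop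
      (𝓝 0) := by
    have h1 := ((tendsto_absorbedProb p.Q₁_transient k).comp
      (NNReal.tendsto_coe_atTop.2 tendsto_id)).const_mul (μ.real B) |>.const_sub (μ.real B)
    simpa using h1
  have hle : ∀ t : ℝ≥0, μ.real ({ω | residualTime J₁₂ J₁ ω = ∞} ∩ B) ≤
      μ.real B - μ.real B * absorbedProb p.Q₁ k t := by
    intro t
    rw [← h.measureReal_postShock_absorbed k t, ← measureReal_sdiff Set.inter_subset_left
      (hB.inter (h.measurableSet_postShock t _))]
    refine measureReal_mono ?_
    rintro ω ⟨hω, hk⟩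
    refine ⟨hk, fun hcon => ?_⟩
    have : residualTime J₁₂ J₁ ω ≤ t :=
      hit_le_of_mem (X := postShock J₁₂ J₁) (D := {Sum.inr (Sum.inr ())}) hcon.2
    rw [hω] at this
    simp at this
  have h0 : μ.real ({ω | residualTime J₁₂ J₁ ω = ∞} ∩ B) = 0 :=
    le_antisymm (ge_of_tendsto' hlim hle) measureReal_nonneg
  rw [measureReal_eq_zero_iff, ← Measure.restrict_apply' hB] at h0
  exact measure_eq_zero_iff_ae_notMem.1 h0

lemma IsModel.ae_toReal_residualTime_le_iff (h : IsModel p μ J₁₂ J₁ J₂) (k : S) (t : ℝ≥0) :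
    ∀ᵐ ω ∂μ.restrict {ω | shockState J₁₂ ω = Sum.inr k},
      (residualTime J₁₂ J₁ ω).toReal ≤ t ↔
        postShock J₁₂ J₁ t ω = Sum.inr (Sum.inr ()) := by
  filter_upwards [h.ae_residualTime_le_iff k t, h.ae_residualTime_ne_top k] with ω h1 h2
  rw [← h1, ← ENNReal.coe_toReal, ENNReal.toReal_le_toReal h2 ENNReal.coe_ne_top]

lemma IsModel.cond_residualTime_le (h : IsModel p μ J₁₂ J₁ J₂) {k : S}
    (hk : μ {ω | shockState J₁₂ ω = Sum.inr k} ≠ 0) (t : ℝ≥0) :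
    (μ[|{ω | shockState J₁₂ ω = Sum.inr k}]).real
      {ω | (residualTime J₁₂ J₁ ω).toReal ≤ t} = absorbedProb p.Q₁ k t := by
  have hB := h.joint.measurableSet_shockState (Sum.inr k)
  have hae := ae_imp_of_ae_restrict (h.ae_toReal_residualTime_le_iff k t)
  rw [cond_measureReal_apply hB]
  have : μ.real ({ω | shockState J₁₂ ω = Sum.inr k} ∩ {ω | (residualTime J₁₂ J₁ ω).toReal ≤ t}) =
      μ.real ({ω | shockState J₁₂ ω = Sum.inr k} ∩
        {ω | postShock J₁₂ J₁ t ω = Sum.inr (Sum.inr ())}) := by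
    refine measureReal_congr ?_
    filter_upwards [hae] with ω hω
    exact propext (and_congr_right hω)
  rw [this, h.measureReal_postShock_absorbed, inv_mul_cancel_left₀]
  rwa [Ne, measureReal_eq_zero_iff]

/-- The moment generating function of the residual time, given the shock state. -/
lemma IsModel.integral_exp_residualTime (h : IsModel p μ J₁₂ J₁ J₂) {c C s : ℝ}
    (hdecay : ∀ t : ℝ, 0 ≤ t → ∀ i j,
      |NormedSpace.exp (t • p.Q₁) i j| ≤ C * Real.exp (-c * t))
    (hs : |s| < c) {k : S} (hk : μ {ω | shockState J₁₂ ω = Sum.inr k} ≠ 0) :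
    Integrable (fun ω => Real.exp (s * (residualTime J₁₂ J₁ ω).toReal))
        (μ[|{ω | shockState J₁₂ ω = Sum.inr k}]) ∧
      ∫ ω, Real.exp (s * (residualTime J₁₂ J₁ ω).toReal)
        ∂(μ[|{ω | shockState J₁₂ ω = Sum.inr k}]) = residualTransform p.Q₁ k s := by
  have := cond_isProbabilityMeasure hk
  set κ := μ[|{ω | shockState J₁₂ ω = Sum.inr k}]
  have hmeas : Measurable fun ω => (residualTime J₁₂ J₁ ω).toReal :=
    h.measurable_residualTime.ennreal_toReal
  have hneg : κ.map (fun ω => (residualTime J₁₂ J₁ ω).toReal) (Set.Iio 0) = 0 := by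
    rw [Measure.map_apply hmeas measurableSet_Iio]
    convert measure_empty (μ := κ)
    ext ω
    simp
  have hcdf : ∀ t, 0 ≤ t →
      (κ.map fun ω => (residualTime J₁₂ J₁ ω).toReal).real (Set.Iic t) =
      ∑ i, (Pi.single k 1 : S → ℝ) i * NormedSpace.exp (t • jointIntensity p.Q₁
        (Matrix.of fun i (_ : Unit) => exitRate p.Q₁ i)) (Sum.inl i) (Sum.inr ()) := by
    intro t ht
    lift t to ℝ≥0 using ht
    rw [map_measureReal_apply hmeas measurableSet_Iic]
    refine (h.cond_residualTime_le hk t).trans ?_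
    simp [Pi.single_apply, absorbedProb, withAbsorption_eq_jointIntensity]
  have h' := integrable_and_integral_exp_of_cdf hdecay hs hneg hcdf
  have hexp : Measurable fun x : ℝ => Real.exp (s * x) := by fun_prop
  rw [integrable_map_measure hexp.aestronglyMeasurable hmeas.aemeasurable,
    integral_map hmeas.aemeasurable hexp.aestronglyMeasurable] at h'
  -- With initial vector eₖ and exit rates as the only target column, `shockTransform` unfolds to
  -- `residualTransform`.
  exact h'

end Residual

/-! ### Conditional independence and the joint transform -/

/-- Lower rays form a π-system generating the Borel sets, so the joint law is the product of its
marginals once they agree on products of rays. -/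
lemma iIndepFun_of_measureReal_Iic {ι Ω : Type*} [Fintype ι] [MeasurableSpace Ω] {κ : Measure Ω}
    [IsProbabilityMeasure κ] {X : ι → Ω → ℝ} (hX : ∀ i, Measurable (X i))
    (h : ∀ a : ι → ℝ, κ.real (⋂ i, X i ⁻¹' Set.Iic (a i)) = ∏ i, κ.real (X i ⁻¹' Set.Iic (a i))) :
    iIndepFun X κ := by
  rw [iIndepFun_iff_map_fun_eq_pi_map fun i => (hX i).aemeasurable]
  have hprob : ∀ i, IsProbabilityMeasure (κ.map (X i)) := fun i =>
    Measure.isProbabilityMeasure_map (hX i).aemeasurable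
  symm
  refine Measure.pi_eq_generateFrom (C := fun _ => Set.range Set.Iic)
    (fun _ => (borel_eq_generateFrom_Iic ℝ).symm) (fun _ => isPiSystem_Iic)
    (fun i => ⟨fun n => Set.Iic (n : ℝ), fun n => ⟨n, rfl⟩, fun n => measure_lt_top _ _, ?_⟩) ?_
  · exact Set.eq_univ_of_forall fun x => Set.mem_iUnion.2 (exists_nat_ge x)
  · intro s hs
    choose a ha using hs
    have hs' : s = fun i => Set.Iic (a i) := funext fun i => (ha i).symm
    rw [hs', Measure.map_apply (measurable_pi_lambda _ hX)
      (MeasurableSet.univ_pi fun i => measurableSet_Iic)]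
    simp only [Measure.map_apply (hX _) measurableSet_Iic]
    have hset : (fun ω i => X i ω) ⁻¹' Set.univ.pi (fun i => Set.Iic (a i)) =
        ⋂ i, X i ⁻¹' Set.Iic (a i) := by
      ext ω
      simp [Pi.le_def]
    rw [hset, ← ENNReal.toReal_eq_toReal_iff' (measure_ne_top _ _)
      (ENNReal.prod_ne_top fun i _ => measure_ne_top _ _), ENNReal.toReal_prod]
    exact h a

section Joint

variable {Ω E S : Type*} [MeasurableSpace Ω] [Fintype E] [DecidableEq E] [Fintype S]
  [DecidableEq S] {p : Params E S} {μ : Measure Ω} [IsProbabilityMeasure μ]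
  {J₁₂ : ℝ≥0 → Ω → E ⊕ S} {J₁ J₂ : ℝ≥0 → Ω → E ⊕ (S ⊕ Unit)}

/-- This is `IsModel.post` for the event {τ ≤ r}, with absorption by t and u read as bounds on the
residual times. -/
lemma IsModel.cond_joint_le (h : IsModel p μ J₁₂ J₁ J₂) (k : S) (r : ℝ) (t u : ℝ≥0) :
    (μ[|{ω | shockState J₁₂ ω = Sum.inr k}]).real ({ω | (shockTime J₁₂ ω).toReal ≤ r} ∩
        {ω | (residualTime J₁₂ J₁ ω).toReal ≤ t} ∩ {ω | (residualTime J₁₂ J₂ ω).toReal ≤ u}) =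
      (μ[|{ω | shockState J₁₂ ω = Sum.inr k}]).real {ω | (shockTime J₁₂ ω).toReal ≤ r} *
        absorbedProb p.Q₁ k t * absorbedProb p.Q₂ k u := by
  have hB := h.joint.measurableSet_shockState (Sum.inr k)
  have hA : MeasurableSet[sigmaOf J₁₂] {ω | (shockTime J₁₂ ω).toReal ≤ r} :=
    (ENNReal.measurable_toReal.comp h.joint.measurable_sigmaOf_shockTime)
      measurableSet_Iic
  have hae₁ := ae_imp_of_ae_restrict (h.ae_toReal_residualTime_le_iff k t)
  have hae₂ := ae_imp_of_ae_restrict (h.swap.ae_toReal_residualTime_le_iff k u)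
  rw [cond_measureReal_apply hB, cond_measureReal_apply hB]
  have : μ.real ({ω | shockState J₁₂ ω = Sum.inr k} ∩ ({ω | (shockTime J₁₂ ω).toReal ≤ r} ∩
        {ω | (residualTime J₁₂ J₁ ω).toReal ≤ t} ∩ {ω | (residualTime J₁₂ J₂ ω).toReal ≤ u})) =
      μ.real ({ω | (shockTime J₁₂ ω).toReal ≤ r} ∩ {ω | shockState J₁₂ ω = Sum.inr k} ∩
        {ω | postShock J₁₂ J₁ t ω = Sum.inr (Sum.inr ())} ∩
        {ω | postShock J₁₂ J₂ u ω = Sum.inr (Sum.inr ())}) := by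
    refine measureReal_congr ?_
    filter_upwards [hae₁, hae₂] with ω h₁ h₂
    refine propext ?_
    change (shockState J₁₂ ω = Sum.inr k ∧ (((shockTime J₁₂ ω).toReal ≤ r ∧
      (residualTime J₁₂ J₁ ω).toReal ≤ t) ∧ (residualTime J₁₂ J₂ ω).toReal ≤ u)) ↔
      ((((shockTime J₁₂ ω).toReal ≤ r ∧ shockState J₁₂ ω = Sum.inr k) ∧
        postShock J₁₂ J₁ t ω = Sum.inr (Sum.inr ())) ∧
        postShock J₁₂ J₂ u ω = Sum.inr (Sum.inr ()))
    change shockState J₁₂ ω = Sum.inr k → _ at h₁ h₂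
    tauto
  rw [this, h.measureReal_postShock_inter hA k t u, Set.inter_comm]
  ring

/-- Given the shock state, the shock time and the two residual times are independent. -/
lemma IsModel.iIndepFun_cond (h : IsModel p μ J₁₂ J₁ J₂) {k : S}
    (hk : μ {ω | shockState J₁₂ ω = Sum.inr k} ≠ 0) :
    iIndepFun ![fun ω => (shockTime J₁₂ ω).toReal, fun ω => (residualTime J₁₂ J₁ ω).toReal,
      fun ω => (residualTime J₁₂ J₂ ω).toReal] (μ[|{ω | shockState J₁₂ ω = Sum.inr k}]) := by
  have := cond_isProbabilityMeasure hk
  refine iIndepFun_of_measureReal_Iic ?_ fun a => ?_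
  · intro i
    fin_cases i
    · exact h.joint.measurable_shockTime.ennreal_toReal
    · exact h.measurable_residualTime.ennreal_toReal
    · exact h.swap.measurable_residualTime.ennreal_toReal
  · have hset : (⋂ i, (![fun ω => (shockTime J₁₂ ω).toReal,
        fun ω => (residualTime J₁₂ J₁ ω).toReal,
        fun ω => (residualTime J₁₂ J₂ ω).toReal] : Fin 3 → Ω → ℝ) i ⁻¹' Set.Iic (a i)) =
        {ω | (shockTime J₁₂ ω).toReal ≤ a 0} ∩ {ω | (residualTime J₁₂ J₁ ω).toReal ≤ a 1} ∩
          {ω | (residualTime J₁₂ J₂ ω).toReal ≤ a 2} := by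
      ext ω
      simp [Fin.forall_fin_succ, and_assoc]
    rw [hset, Fin.prod_univ_three]
    change _ = (μ[|{ω | shockState J₁₂ ω = Sum.inr k}]).real {ω | (shockTime J₁₂ ω).toReal ≤ a 0} *
      (μ[|{ω | shockState J₁₂ ω = Sum.inr k}]).real {ω | (residualTime J₁₂ J₁ ω).toReal ≤ a 1} *
      (μ[|{ω | shockState J₁₂ ω = Sum.inr k}]).real {ω | (residualTime J₁₂ J₂ ω).toReal ≤ a 2}
    -- The model speaks only of nonnegative times; for a negative threshold on a residual time both
    -- sides vanish.
    have hempty : ∀ (J : ℝ≥0 → Ω → E ⊕ (S ⊕ Unit)) (b : ℝ), b < 0 →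
        {ω | (residualTime J₁₂ J ω).toReal ≤ b} = ∅ := fun J b hb =>
      Set.eq_empty_of_forall_notMem fun ω hω =>
        absurd (hω.trans_lt hb) (not_lt.2 ENNReal.toReal_nonneg)
    rcases lt_or_ge (a 1) 0 with h1 | h1
    · simp [hempty _ _ h1]
    rcases lt_or_ge (a 2) 0 with h2 | h2
    · simp [hempty _ _ h2]
    obtain ⟨t, ht⟩ : ∃ t : ℝ≥0, (t : ℝ) = a 1 := ⟨⟨a 1, h1⟩, rfl⟩
    obtain ⟨u, hu⟩ : ∃ u : ℝ≥0, (u : ℝ) = a 2 := ⟨⟨a 2, h2⟩, rfl⟩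
    rw [← ht, ← hu, h.cond_joint_le k, h.cond_residualTime_le hk, h.swap.cond_residualTime_le hk]
    rfl

lemma integrable_and_integral_exp_sum_three {κ : Measure Ω} {X₀ X₁ X₂ : Ω → ℝ} {s₀ s₁ s₂ : ℝ}
    (hind : iIndepFun ![X₀, X₁, X₂] κ) (h₀ : Measurable X₀) (h₁ : Measurable X₁)
    (h₂ : Measurable X₂) (hi₀ : Integrable (fun ω => Real.exp (s₀ * X₀ ω)) κ)
    (hi₁ : Integrable (fun ω => Real.exp (s₁ * X₁ ω)) κ)
    (hi₂ : Integrable (fun ω => Real.exp (s₂ * X₂ ω)) κ) :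
    Integrable (fun ω => Real.exp (s₀ * X₀ ω + s₁ * X₁ ω + s₂ * X₂ ω)) κ ∧
      ∫ ω, Real.exp (s₀ * X₀ ω + s₁ * X₁ ω + s₂ * X₂ ω) ∂κ =
        (∫ ω, Real.exp (s₀ * X₀ ω) ∂κ) * (∫ ω, Real.exp (s₁ * X₁ ω) ∂κ) *
          ∫ ω, Real.exp (s₂ * X₂ ω) ∂κ := by
  have := hind.isProbabilityMeasure
  -- Absorbing the different exponents into the variables reduces the claim to the moment generating
  -- function of an independent sum at 1.
  let Y : Fin 3 → Ω → ℝ := fun i ω => ![s₀, s₁, s₂] i * (![X₀, X₁, X₂] : Fin 3 → Ω → ℝ) i ω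
  have hY : iIndepFun Y κ := hind.comp (fun i x => ![s₀, s₁, s₂] i * x) fun i => by fun_prop
  have hYm : ∀ i, Measurable (Y i) := by
    intro i
    fin_cases i
    · exact h₀.const_mul s₀
    · exact h₁.const_mul s₁
    · exact h₂.const_mul s₂
  have hint := hY.integrable_exp_mul_sum (t := 1) hYm (s := Finset.univ) (by
    intro i _
    fin_cases i
    · simpa [Y] using hi₀
    · simpa [Y] using hi₁
    · simpa [Y] using hi₂)
  have hmgf := hY.mgf_sum (t := 1) hYm Finset.univ
  simp only [mgf, Fin.prod_univ_three, Finset.sum_apply, Fin.sum_univ_three, one_mul, Y,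
    Matrix.cons_val_zero, Matrix.cons_val_one, Matrix.cons_val] at hint hmgf
  exact ⟨hint, hmgf⟩

/-- The joint moment generating function on the event that the shock state is `k`. -/
lemma IsModel.setIntegral_exp_component (h : IsModel p μ J₁₂ J₁ J₂) {c c₁ c₂ C C₁ C₂ s₁ s₂ : ℝ}
    (hT : ∀ t : ℝ, 0 ≤ t → ∀ i j, |NormedSpace.exp (t • p.T) i j| ≤ C * Real.exp (-c * t))
    (hQ₁ : ∀ t : ℝ, 0 ≤ t → ∀ i j, |NormedSpace.exp (t • p.Q₁) i j| ≤ C₁ * Real.exp (-c₁ * t))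
    (hQ₂ : ∀ t : ℝ, 0 ≤ t → ∀ i j, |NormedSpace.exp (t • p.Q₂) i j| ≤ C₂ * Real.exp (-c₂ * t))
    (hs : |p.a₁ * s₁ + p.a₂ * s₂| < c) (hs₁ : |s₁| < c₁) (hs₂ : |s₂| < c₂) (k : S) :
    IntegrableOn (fun ω => Real.exp
        (s₁ * component p.a₁ J₁₂ J₁ ω + s₂ * component p.a₂ J₁₂ J₂ ω))
        {ω | shockState J₁₂ ω = Sum.inr k} μ ∧
      ∫ ω in {ω | shockState J₁₂ ω = Sum.inr k}, Real.exp
          (s₁ * component p.a₁ J₁₂ J₁ ω + s₂ * component p.a₂ J₁₂ J₂ ω) ∂μ =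
        shockTransform p.α p.T p.U k (p.a₁ * s₁ + p.a₂ * s₂) *
          residualTransform p.Q₁ k s₁ * residualTransform p.Q₂ k s₂ := by
  obtain ⟨hshock_int, hshock⟩ := h.joint.integral_exp_shockTime hT hs k
  -- If {K = k} is null there is no conditional law, but the shock transform, being an integral over
  -- that event, is 0, and so are both sides.
  by_cases hk : μ {ω | shockState J₁₂ ω = Sum.inr k} = 0
  · rw [← hshock, IntegrableOn, Measure.restrict_eq_zero.2 hk]
    simp
  obtain ⟨hi₁, he₁⟩ := h.integral_exp_residualTime hQ₁ hs₁ hk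
  obtain ⟨hi₂, he₂⟩ := h.swap.integral_exp_residualTime hQ₂ hs₂ hk
  change _ = residualTransform p.Q₂ k s₂ at he₂
  -- The factor P(K = k) gained on leaving the conditional law is exactly the one contained in the
  -- shock transform, which is not conditioned.
  have hrestrict : μ.restrict {ω | shockState J₁₂ ω = Sum.inr k} =
      μ {ω | shockState J₁₂ ω = Sum.inr k} • μ[|{ω | shockState J₁₂ ω = Sum.inr k}] := by
    rw [ProbabilityTheory.cond, smul_smul, ENNReal.mul_inv_cancel hk (measure_ne_top _ _), one_smul]
  rw [IntegrableOn, hrestrict, integrable_smul_measure hk (measure_ne_top _ _)] at hshock_int ⊢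
  rw [hrestrict, integral_smul_measure] at hshock
  obtain ⟨hint, heq⟩ := integrable_and_integral_exp_sum_three (h.iIndepFun_cond hk)
    h.joint.measurable_shockTime.ennreal_toReal
    h.measurable_residualTime.ennreal_toReal h.swap.measurable_residualTime.ennreal_toReal
    hshock_int hi₁ hi₂
  have hfun : (fun ω => Real.exp
      (s₁ * component p.a₁ J₁₂ J₁ ω + s₂ * component p.a₂ J₁₂ J₂ ω)) = fun ω => Real.exp
      ((p.a₁ * s₁ + p.a₂ * s₂) * (shockTime J₁₂ ω).toReal +
        s₁ * (residualTime J₁₂ J₁ ω).toReal + s₂ * (residualTime J₁₂ J₂ ω).toReal) := by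
    funext ω
    simp only [component]
    ring_nf
  rw [hfun]
  refine ⟨hint, ?_⟩
  rw [integral_smul_measure, heq, he₁, he₂, ← hshock, smul_eq_mul, smul_eq_mul]
  ring

lemma IsModel.integral_exp_component (h : IsModel p μ J₁₂ J₁ J₂) {c c₁ c₂ C C₁ C₂ s₁ s₂ : ℝ}
    (hT : ∀ t : ℝ, 0 ≤ t → ∀ i j, |NormedSpace.exp (t • p.T) i j| ≤ C * Real.exp (-c * t))
    (hQ₁ : ∀ t : ℝ, 0 ≤ t → ∀ i j, |NormedSpace.exp (t • p.Q₁) i j| ≤ C₁ * Real.exp (-c₁ * t))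
    (hQ₂ : ∀ t : ℝ, 0 ≤ t → ∀ i j, |NormedSpace.exp (t • p.Q₂) i j| ≤ C₂ * Real.exp (-c₂ * t))
    (hs : |p.a₁ * s₁ + p.a₂ * s₂| < c) (hs₁ : |s₁| < c₁) (hs₂ : |s₂| < c₂) :
    Integrable (fun ω => Real.exp
        (s₁ * component p.a₁ J₁₂ J₁ ω + s₂ * component p.a₂ J₁₂ J₂ ω)) μ ∧
      ∫ ω, Real.exp (s₁ * component p.a₁ J₁₂ J₁ ω + s₂ * component p.a₂ J₁₂ J₂ ω) ∂μ =
        ∑ k : S, shockTransform p.α p.T p.U k (p.a₁ * s₁ + p.a₂ * s₂) *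
          residualTransform p.Q₁ k s₁ * residualTransform p.Q₂ k s₂ := by
  have hpiece := h.setIntegral_exp_component hT hQ₁ hQ₂ hs hs₁ hs₂
  have huniv : μ.restrict (⋃ k : S, {ω | shockState J₁₂ ω = Sum.inr k}) = μ := by
    refine Measure.restrict_eq_self_of_ae_mem ?_
    filter_upwards [h.joint.exists_shockState p.T_transient] with ω hω
    exact Set.mem_iUnion.2 hω
  have hdisj : Pairwise (Function.onFun Disjoint
      fun k : S => {ω | shockState J₁₂ ω = Sum.inr k}) := fun k k' hkk' =>
    Set.disjoint_left.2 fun ω hω hω' => hkk' (Sum.inr_injective (hω.symm.trans hω'))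
  have hint := integrableOn_finite_iUnion.2 fun k => (hpiece k).1
  have heq := integral_iUnion_fintype
    (fun k => h.joint.measurableSet_shockState (Sum.inr k)) hdisj
    fun k => (hpiece k).1
  rw [IntegrableOn, huniv] at hint
  rw [huniv] at heq
  exact ⟨hint, heq.trans (Finset.sum_congr rfl fun k _ => (hpiece k).2)⟩

end Joint

end CSPH

end

/-! ### The main theorem -/

theorem mainTheorem4 {E S : Type*} [Fintype E] [DecidableEq E] [Fintype S] [DecidableEq S]
    (p : CSPH.Params E S) :
    ∃ δ : ℝ, 0 < δ ∧ ∀ {Ω Ω' : Type*} [MeasurableSpace Ω] [MeasurableSpace Ω']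
      (μ : Measure Ω) [IsProbabilityMeasure μ]
      (J₁₂ : ℝ≥0 → Ω → E ⊕ S) (J₁ J₂ : ℝ≥0 → Ω → E ⊕ (S ⊕ Unit))
      (_ : CSPH.IsModel p μ J₁₂ J₁ J₂)
      (ν : Measure Ω') (X₁ X₂ : Ω' → ℝ)
      (_ : IdentDistrib (fun ω => (X₁ ω, X₂ ω))
        (fun ω => (CSPH.component p.a₁ J₁₂ J₁ ω, CSPH.component p.a₂ J₁₂ J₂ ω)) ν μ)
      (s₁ s₂ : ℝ), |s₁| < δ → |s₂| < δ →
      -- the matrix inverses exist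
      IsUnit (-p.T - (p.a₁ * s₁ + p.a₂ * s₂) • (1 : Matrix E E ℝ)) ∧
      IsUnit (-p.Q₁ - s₁ • (1 : Matrix S S ℝ)) ∧
      IsUnit (-p.Q₂ - s₂ • (1 : Matrix S S ℝ)) ∧
      -- the joint moment generating function is finite and factorizes
      Integrable (fun ω => Real.exp (s₁ * X₁ ω + s₂ * X₂ ω)) ν ∧
      ∫ ω, Real.exp (s₁ * X₁ ω + s₂ * X₂ ω) ∂ν =
        ∑ k : S, CSPH.shockTransform p.α p.T p.U k (p.a₁ * s₁ + p.a₂ * s₂) *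
          CSPH.residualTransform p.Q₁ k s₁ * CSPH.residualTransform p.Q₂ k s₂ ∧
      -- the factors are the transforms of the common-shock time and of the residual times
      ∀ k : S,
        (IntegrableOn (fun ω => Real.exp
            ((p.a₁ * s₁ + p.a₂ * s₂) * (CSPH.shockTime J₁₂ ω).toReal))
            {ω | CSPH.shockState J₁₂ ω = Sum.inr k} μ ∧
          ∫ ω in {ω | CSPH.shockState J₁₂ ω = Sum.inr k}, Real.exp
            ((p.a₁ * s₁ + p.a₂ * s₂) * (CSPH.shockTime J₁₂ ω).toReal) ∂μ =
            CSPH.shockTransform p.α p.T p.U k (p.a₁ * s₁ + p.a₂ * s₂)) ∧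
        (μ {ω | CSPH.shockState J₁₂ ω = Sum.inr k} ≠ 0 →
          (Integrable (fun ω => Real.exp (s₁ * (CSPH.residualTime J₁₂ J₁ ω).toReal))
              (μ[|{ω | CSPH.shockState J₁₂ ω = Sum.inr k}]) ∧
            ∫ ω, Real.exp (s₁ * (CSPH.residualTime J₁₂ J₁ ω).toReal)
              ∂(μ[|{ω | CSPH.shockState J₁₂ ω = Sum.inr k}]) =
              CSPH.residualTransform p.Q₁ k s₁) ∧
          (Integrable (fun ω => Real.exp (s₂ * (CSPH.residualTime J₁₂ J₂ ω).toReal))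
              (μ[|{ω | CSPH.shockState J₁₂ ω = Sum.inr k}]) ∧
            ∫ ω, Real.exp (s₂ * (CSPH.residualTime J₁₂ J₂ ω).toReal)
              ∂(μ[|{ω | CSPH.shockState J₁₂ ω = Sum.inr k}]) =
              CSPH.residualTransform p.Q₂ k s₂)) := by
  obtain ⟨c, hc, C, hT⟩ := p.T_transient.exists_decay
  obtain ⟨c₁, hc₁, C₁, hQ₁⟩ := p.Q₁_transient.exists_decay
  obtain ⟨c₂, hc₂, C₂, hQ₂⟩ := p.Q₂_transient.exists_decay
  have ha : 0 < p.a₁ + p.a₂ := add_pos p.a₁_pos p.a₂_pos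
  -- The decay rates come from the parameters alone, before any process is introduced. Dividing c by
  -- a₁ + a₂ keeps |a₁s₁ + a₂s₂| below c.
  refine ⟨min (c / (p.a₁ + p.a₂)) (min c₁ c₂), lt_min (div_pos hc ha) (lt_min hc₁ hc₂), ?_⟩
  intro Ω Ω' _ _ μ _ J₁₂ J₁ J₂ h ν X₁ X₂ hX s₁ s₂ hs₁ hs₂
  simp only [lt_min_iff] at hs₁ hs₂
  obtain ⟨hsT₁, hs₁, -⟩ := hs₁
  obtain ⟨hsT₂, -, hs₂⟩ := hs₂
  have hs : |p.a₁ * s₁ + p.a₂ * s₂| < c := by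
    have h₁ := mul_lt_mul_of_pos_left hsT₁ p.a₁_pos
    have h₂ := mul_lt_mul_of_pos_left hsT₂ p.a₂_pos
    calc |p.a₁ * s₁ + p.a₂ * s₂| ≤ |p.a₁ * s₁| + |p.a₂ * s₂| := abs_add_le _ _
      _ = p.a₁ * |s₁| + p.a₂ * |s₂| := by
          rw [abs_mul, abs_mul, abs_of_pos p.a₁_pos, abs_of_pos p.a₂_pos]
      _ < p.a₁ * (c / (p.a₁ + p.a₂)) + p.a₂ * (c / (p.a₁ + p.a₂)) := add_lt_add h₁ h₂
      _ = c := by rw [← add_mul, mul_div_cancel₀ _ ha.ne']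
  have hexp : Measurable fun x : ℝ × ℝ => Real.exp (s₁ * x.1 + s₂ * x.2) := by fun_prop
  have hid := hX.comp hexp
  obtain ⟨hint, heq⟩ := h.integral_exp_component hT hQ₁ hQ₂ hs hs₁ hs₂
  exact ⟨CSPH.isUnit_neg_sub_smul_one hT hs, CSPH.isUnit_neg_sub_smul_one hQ₁ hs₁,
    CSPH.isUnit_neg_sub_smul_one hQ₂ hs₂, hid.integrable_iff.2 hint, hid.integral_eq.trans heq,
    fun k => ⟨h.joint.integral_exp_shockTime hT hs k, fun hk =>
      ⟨h.integral_exp_residualTime hQ₁ hs₁ hk, h.swap.integral_exp_residualTime hQ₂ hs₂ hk⟩⟩⟩
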